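/- Let $d\ge 1$, let $\sigma$ be the uniform probability measure on the unit sphere $\mathbb S^{d-1}\subset\mathbb R^d$, and let $\varphi(x,y)=f(\langle x,y\rangle)$ with $f:[-1,1]\to[0,\infty)$ monotone and continuous, such that $\int_{\mathbb S^{d-1}}\varphi(x,y)\,d\sigma(y)=1$ for all $x\in\mathbb S^{d-1}$. Put $$\lambda=\lambda(\varphi):=\int_{\mathbb S^{d-1}}\langle x,e_1\rangle\,\varphi(e_1,x)\,d\sigma(x).$$ Let $A_\varphi\psi(x)=\int\varphi(x,y)\psi(y)\,d\sigma(y)$ be the associated integral operator on $L^2(\sigma)$, and let $\lambda_0=1,\lambda_1,\lambda_2,\dots$ be its eigenvalues with respect to an orthonormal basis $\psi_0\equiv 1,\psi_1,\psi_2,\dots$ of eigenfunctions (spherical harmonics); thus the $\lambda_i$ with $i\ge1$ are the eigenvalues of $A_\varphi$ having a nonzero eigenfunction of mean zero. Assume that $\lambda(\varphi)>0$ and $|\lambda_i|\le\lambda(\varphi)$ for all $i\ge 1$. Let $T$ be a rooted tree with root $r$, let $T_k$ be its set of vertices at depth $k$, and assume that $T$ has growth at most $q$, where $q>1$ is real: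 $|T_k|\le\lceil q^k\rceil$ for every $k\in\mathbb N$. Label the vertices of $T$ at random by points $g(v)\in\mathbb S^{d-1}$: $g(r)$ has law $\sigma$, and, given the labels at depth $\le\ell$, the labels of the vertices $u$ at depth $\ell+1$ are independent, $g(u)$ having law $\varphi(g(v),\cdot)\,d\sigma$, where $v$ is the parent of $u$. Let $\mu_k$ be the conditional distribution of $g(r)$ given $(g(v))_{v\in T_k}$. There is a universal constant $c>0$ (independent of $d,f,T,q$) such that, if $$q\le\left(1-c\,\frac{\ln(\lambda)\,(1-\lambda)^2}{\ln\left(\frac{\lambda(1-\lambda)}{f(1)}\right)}\right)^{-1},$$ then the model has zero percolation of information, that is, $\lim_{k\to\infty}\mathbb E\left[\mathrm{TV}(\mu_k,\sigma)\right]=0$. -/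

import Mathlib

open MeasureTheory ProbabilityTheory Set Filter Topology
open scoped ENNReal InnerProductSpace

/-! ### The sphere, its uniform measure, and rotation invariant kernels -/

/-- The unit sphere `S^{d-1}` of the Euclidean space `ℝ^d`. -/
abbrev Sph (d : ℕ) : Type := Metric.sphere (0 : EuclideanSpace ℝ (Fin d)) 1

/-- The north pole `e₁` of `S^{d-1}`, for `d ≥ 1`. -/
noncomputable def northPole (d : ℕ) [NeZero d] : Sph d :=
  ⟨EuclideanSpace.single (0 : Fin d) (1 : ℝ), by simp⟩

instance instNonemptySph (d : ℕ) [NeZero d] : Nonempty (Sph d) := ⟨northPole d⟩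

/-- The uniform probability measure `σ` on `S^{d-1}`: normalised surface measure. -/
noncomputable def unif (d : ℕ) : Measure (Sph d) :=
  ((volume : Measure (EuclideanSpace ℝ (Fin d))).toSphere univ)⁻¹ •
    (volume : Measure (EuclideanSpace ℝ (Fin d))).toSphere

instance instIsProbabilityMeasureUnif (d : ℕ) [NeZero d] : IsProbabilityMeasure (unif d) := by
  have : Nontrivial (EuclideanSpace ℝ (Fin d)) :=
    ⟨⟨EuclideanSpace.single (0 : Fin d) (1 : ℝ), 0, by simp⟩⟩
  refine ⟨?_⟩
  rw [unif, Measure.smul_apply, smul_eq_mul]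
  exact ENNReal.inv_mul_cancel
    (fun h => Measure.toSphere_ne_zero (volume : Measure (EuclideanSpace ℝ (Fin d)))
      (Measure.measure_univ_eq_zero.1 h))
    (measure_ne_top _ _)

/-- The function `φ(x, y) = f(⟨x, y⟩)` on `S^{d-1} × S^{d-1}`. -/
noncomputable def phi {d : ℕ} (f : ℝ → ℝ) (x y : Sph d) : ℝ :=
  f ⟪(x : EuclideanSpace ℝ (Fin d)), (y : EuclideanSpace ℝ (Fin d))⟫_ℝ

/-- The kernel `x ↦ φ(x, ·) dσ` on `S^{d-1}`. For `f` nonnegative and continuous on `[-1, 1]`, it is a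
Markov kernel if and only if `∫ φ(x, y) dσ(y) = 1` for all `x`. -/
noncomputable def sphereKernel (d : ℕ) [NeZero d] (f : ℝ → ℝ) : Kernel (Sph d) (Sph d) :=
  Kernel.withDensity (Kernel.const (Sph d) (unif d)) (fun x y => ENNReal.ofReal (phi f x y))

/-- `λ(φ) = ∫ ⟨x, e₁⟩ φ(e₁, x) dσ(x)`, the eigenvalue on linear functionals. -/
noncomputable def lam (d : ℕ) [NeZero d] (f : ℝ → ℝ) : ℝ :=
  ∫ x : Sph d, ⟪(x : EuclideanSpace ℝ (Fin d)), (northPole d : EuclideanSpace ℝ (Fin d))⟫_ℝ *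
    phi f (northPole d) x ∂(unif d)

/-- The integral operator `A_φ(ψ)(x) = ∫ φ(x, y) ψ(y) dσ(y)`. -/
noncomputable def integralOp {d : ℕ} (f : ℝ → ℝ) (ψ : Sph d → ℝ) (x : Sph d) : ℝ :=
  ∫ y, phi f x y * ψ y ∂(unif d)

/-- `m` is an eigenvalue of `A_φ` on `L²(σ)` with an eigenfunction orthogonal to the constants.
These are exactly the numbers `λ_i`, `i ≥ 1`, of the expansion `φ = ∑ λ_i ψ_i ⊗ ψ_i` over an
orthonormal basis of eigenfunctions (spherical harmonics) that starts with `ψ_0 = 1`. -/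
def IsNonconstantEigenvalue (d : ℕ) (f : ℝ → ℝ) (m : ℝ) : Prop :=
  ∃ ψ : Sph d → ℝ, MemLp ψ 2 (unif d) ∧ ¬ (ψ =ᵐ[unif d] 0) ∧ (∫ x, ψ x ∂(unif d) = 0) ∧
    integralOp f ψ =ᵐ[unif d] fun x => m * ψ x

/-! ### Rooted trees -/

/-- The set `T_k` of vertices at depth `k` in the graph `G` rooted at `r`. -/
abbrev Level {V : Type*} (G : SimpleGraph V) (r : V) (k : ℕ) : Type _ := {v : V // G.dist r v = k}

/-- In a rooted tree every vertex at depth `k + 1` has exactly one neighbour at depth `k`. -/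
theorem existsUnique_parent {V : Type*} {G : SimpleGraph V} (hG : G.IsTree) (r : V) (k : ℕ)
    (u : Level G r (k + 1)) : ∃! v : Level G r k, G.Adj v u := by
  obtain ⟨p, hp⟩ := hG.1.exists_walk_length_eq_dist r u.1
  have hnn : ¬ p.Nil := by
    intro h
    have := SimpleGraph.Walk.length_eq_zero_iff.2 h
    have := u.2
    omega
  have hadj : G.Adj p.penultimate u := p.adj_penultimate hnn
  have h1 : G.dist r p.penultimate ≤ k := by
    refine (SimpleGraph.dist_le p.dropLast).trans ?_
    have := u.2
    have : p.dropLast.length + 1 = p.length := p.length_dropLast_add_one hnn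
    omega
  have h2 : k + 1 ≤ G.dist r p.penultimate + 1 := by
    have h := hG.1.dist_triangle (u := r) (v := p.penultimate) (w := u.1)
    rw [SimpleGraph.dist_eq_one_iff_adj.2 hadj, u.2] at h
    exact h
  refine ⟨⟨p.penultimate, by omega⟩, hadj, ?_⟩
  rintro ⟨w, hw⟩ (hwu : G.Adj w u)
  obtain ⟨p', hp'⟩ := hG.1.exists_walk_length_eq_dist r w
  have hP : p.IsPath := p.isPath_of_length_eq_dist hp
  have hP' : (p'.concat hwu).IsPath := by
    apply SimpleGraph.Walk.isPath_of_length_eq_dist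
    rw [SimpleGraph.Walk.length_concat, hp', hw, u.2]
  have h3 : p = p'.concat hwu :=
    congrArg Subtype.val ((hG.2.subsingleton_path _ _).elim ⟨p, hP⟩ ⟨_, hP'⟩)
  apply Subtype.ext
  simp [h3]

/-- The parent of a vertex at depth `k + 1`. -/
noncomputable def parent {V : Type*} {G : SimpleGraph V} (hG : G.IsTree) (r : V) (k : ℕ)
    (u : Level G r (k + 1)) : Level G r k :=
  (existsUnique_parent hG r k u).choose

/-- The rooted tree has growth at most `q`: `q > 1` and `|T_k| ≤ ⌈q^k⌉` for every `k`. -/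
def GrowthAtMost {V : Type*} (G : SimpleGraph V) (r : V) [∀ k, Finite (Level G r k)] (q : ℝ) :
    Prop :=
  1 < q ∧ ∀ k : ℕ, Nat.card (Level G r k) ≤ ⌈q ^ k⌉₊

/-! ### The labelling of the tree -/

section Labelling

variable {S : Type*} [MeasurableSpace S]

theorem measurable_pi_kernel {ι κ : Type*} [Fintype ι] (K : Kernel S S) [IsMarkovKernel K]
    (p : ι → κ) : Measurable fun x : κ → S => Measure.pi fun i => K (x (p i)) := by
  refine Measurable.measure_of_isPiSystem_of_isProbabilityMeasure generateFrom_pi.symm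
    isPiSystem_pi ?_
  rintro _ ⟨s, hs, rfl⟩
  simp only [Measure.pi_pi]
  exact Finset.measurable_prod _ fun i _ =>
    (K.measurable_coe (hs i (mem_univ i))).comp (measurable_pi_apply (p i))

variable {V : Type*} {G : SimpleGraph V}

/-- Given the labels at depth `k`, the labels at depth `k + 1` are independent, the label of `u`
being distributed according to `K (label of the parent of u)`. -/
noncomputable def stepKernel (K : Kernel S S) [IsMarkovKernel K] (hG : G.IsTree) (r : V)
    [∀ k, Finite (Level G r k)] (k : ℕ) : Kernel (Level G r k → S) (Level G r (k + 1) → S) :=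
  letI : Fintype (Level G r (k + 1)) := Fintype.ofFinite _
  ⟨fun x => Measure.pi fun u => K (x (parent hG r k u)), measurable_pi_kernel K _⟩

instance instIsMarkovKernelStepKernel (K : Kernel S S) [IsMarkovKernel K] (hG : G.IsTree) (r : V)
    [∀ k, Finite (Level G r k)] (k : ℕ) : IsMarkovKernel (stepKernel K hG r k) := by
  let : Fintype (Level G r (k + 1)) := Fintype.ofFinite _
  exact ⟨fun x => inferInstanceAs
    (IsProbabilityMeasure (Measure.pi fun u => K (x (parent hG r k u))))⟩

/-- The conditional law of the labels `(g(v))_{v ∈ T_k}` given the label `g(r)` of the root. -/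
noncomputable def levelKernel (K : Kernel S S) [IsMarkovKernel K] (hG : G.IsTree) (r : V)
    [∀ k, Finite (Level G r k)] : (k : ℕ) → Kernel S (Level G r k → S)
  | 0 => Kernel.deterministic (fun x _ => x) (measurable_pi_lambda _ fun _ => measurable_id)
  | k + 1 => (stepKernel K hG r k).comp (levelKernel K hG r k)

instance instIsMarkovKernelLevelKernel (K : Kernel S S) [IsMarkovKernel K] (hG : G.IsTree) (r : V)
    [∀ k, Finite (Level G r k)] (k : ℕ) : IsMarkovKernel (levelKernel K hG r k) := by
  induction k with
  | zero => rw [levelKernel]; infer_instance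
  | succ k ih => rw [levelKernel]; infer_instance

end Labelling

/-! ### Percolation of information -/

/-- Total variation distance `sup_A |μ(A) - ν(A)|` of probability measures. -/
noncomputable def tvDist {S : Type*} [MeasurableSpace S] (μ ν : Measure S) : ℝ≥0∞ :=
  ⨆ (A : Set S) (_ : MeasurableSet A), ENNReal.ofReal |μ.real A - ν.real A|

/-- `E[TV(μ_k, σ)]`, where the root label is uniform, the labels at depth `k` are drawn from
`levelKernel` given the root label, and `μ_k` is the conditional distribution of the root label
given the labels at depth `k`. -/
noncomputable def expectedTV (d : ℕ) [NeZero d] (f : ℝ → ℝ) [IsMarkovKernel (sphereKernel d f)]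
    {V : Type*} {G : SimpleGraph V} (hG : G.IsTree) (r : V) [∀ k, Finite (Level G r k)]
    (k : ℕ) : ℝ≥0∞ :=
  ∫⁻ y, tvDist (posterior (levelKernel (sphereKernel d f) hG r k) (unif d) y) (unif d)
    ∂((unif d).bind (levelKernel (sphereKernel d f) hG r k))

/-- Zero percolation of information: `lim_{k → ∞} E[TV(μ_k, σ)] = 0`. -/
def ZeroPercolation (d : ℕ) [NeZero d] (f : ℝ → ℝ) [IsMarkovKernel (sphereKernel d f)]
    {V : Type*} {G : SimpleGraph V} (hG : G.IsTree) (r : V) [∀ k, Finite (Level G r k)] : Prop :=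
  Tendsto (fun k => expectedTV d f hG r k) atTop (𝓝 0)

set_option linter.unusedSectionVars false

/-! ### Symmetric Markov densities and hypercontractivity -/

/-! Each edge of the tree destroys a fixed proportion of the information about the root, while the
number of observations grows at most like `q ^ k`. If the product of the two factors is below 1, the
mutual information between the root and level `k` tends to 0, and so does the expected total
variation.

The loss per edge comes from hypercontractivity. Let A be the averaging operator of φ, and let M =
f(1), which bounds φ. If u ≥ 0 has L² norm 1, then 0 ≤ Au ≤ √M pointwise, and the spectral
hypothesis gives Var(Au) ≤ λ² Var(u). Expanding t^(2+δ) to second order about the mean of u shows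
that A is a contraction from L² to L^(2+δ) on nonnegative functions as soon as (2+δ)(1+δ)/2 ·
M^(δ/2) · λ² ≤ 1 (`IsSymmDensity.integral_avg_rpow_le`). The duality between t log t and the
exponential turns this into Ent(Ah) ≤ 2/(2+δ) · Ent(h) (`IsSymmDensity.entropy_avg_le`), hence into
a strong data processing inequality (`IsLikelihood.info_avg_le`).

On the tree, the likelihoods coming from different children multiply, and mutual information is
subadditive over them (`IsLikelihood.info_mul_le`). Climbing from depth k to the root
(`exists_likelihood`) gives information at most (2/(2+δ))^(k-1) · |T_k| · log M, and a Pinsker type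
bound passes to total variation. Taking δ equal to `rate` meets the hypercontractivity condition
(`rate_bounds`), and c = 1/4 makes 2q/(2+δ) < 1.

The variance contraction is deduced from the eigenvalue bound because A is compact and self-adjoint
(`hasVarianceContraction_of_forall_eigenvalue`). -/

theorem integrable_of_measurable_of_bound {S : Type*} [MeasurableSpace S] {σ : Measure S}
    [IsFiniteMeasure σ] {h : S → ℝ} {C : ℝ} (hm : Measurable h) (hb : ∀ x, |h x| ≤ C) :
    Integrable h σ :=
  Integrable.of_bound hm.aestronglyMeasurable C (Eventually.of_forall hb)

theorem integral_linear_combination {S : Type*} [MeasurableSpace S] {σ : Measure S} {f g h : S → ℝ}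
    (hf : Integrable f σ) (hg : Integrable g σ) (hh : Integrable h σ) (a b c : ℝ) :
    ∫ x, (a * f x + b * g x + c * h x) ∂σ =
      a * ∫ x, f x ∂σ + b * ∫ x, g x ∂σ + c * ∫ x, h x ∂σ := by
  have h1 : Integrable (fun x => a * f x + b * g x) σ := (hf.const_mul a).add (hg.const_mul b)
  rw [integral_add h1 (hh.const_mul c), integral_add (hf.const_mul a) (hg.const_mul b),
    integral_const_mul, integral_const_mul, integral_const_mul]

/-- A bounded symmetric transition density with respect to `σ`. -/
structure IsSymmDensity {S : Type*} [MeasurableSpace S] (σ : Measure S) (φ : S → S → ℝ)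
    (M : ℝ) : Prop where
  meas : Measurable (Function.uncurry φ)
  nonneg : ∀ x y, 0 ≤ φ x y
  le : ∀ x y, φ x y ≤ M
  symm : ∀ x y, φ x y = φ y x
  integral_eq_one : ∀ x, ∫ y, φ x y ∂σ = 1

/-- The averaging operator of a transition density. -/
noncomputable def avg {S : Type*} [MeasurableSpace S] (σ : Measure S) (φ : S → S → ℝ)
    (h : S → ℝ) (x : S) : ℝ := ∫ y, φ x y * h y ∂σ

section Avg

variable {S : Type*} [MeasurableSpace S] {σ : Measure S} [IsProbabilityMeasure σ]
  {φ : S → S → ℝ} {M : ℝ}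

theorem IsSymmDensity.measurable_right (hφ : IsSymmDensity σ φ M) (x : S) : Measurable (φ x) :=
  hφ.meas.comp measurable_prodMk_left

theorem IsSymmDensity.abs_apply_le (hφ : IsSymmDensity σ φ M) (x y : S) : |φ x y| ≤ M := by
  rw [abs_of_nonneg (hφ.nonneg x y)]; exact hφ.le x y

theorem IsSymmDensity.integrable_mul (hφ : IsSymmDensity σ φ M) {h : S → ℝ} {C : ℝ}
    (hm : Measurable h) (hb : ∀ x, |h x| ≤ C) (x : S) : Integrable (fun y => φ x y * h y) σ := by
  refine integrable_of_measurable_of_bound (C := M * C) ((hφ.measurable_right x).mul hm) fun y => ?_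
  rw [abs_mul]
  exact mul_le_mul (hφ.abs_apply_le x y) (hb y) (abs_nonneg _)
    ((abs_nonneg _).trans (hφ.abs_apply_le x y))

theorem IsSymmDensity.integrable (hφ : IsSymmDensity σ φ M) (x : S) : Integrable (φ x) σ :=
  integrable_of_measurable_of_bound (hφ.measurable_right x) (hφ.abs_apply_le x)

theorem IsSymmDensity.one_le (hφ : IsSymmDensity σ φ M) : 1 ≤ M := by
  obtain ⟨x⟩ := nonempty_of_isProbabilityMeasure σ
  calc (1 : ℝ) = ∫ y, φ x y ∂σ := (hφ.integral_eq_one x).symm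
    _ ≤ ∫ _, M ∂σ := integral_mono (hφ.integrable x) (integrable_const M) (hφ.le x)
    _ = M := by simp

theorem IsSymmDensity.measurable_avg (hφ : IsSymmDensity σ φ M) {h : S → ℝ} (hm : Measurable h) :
    Measurable (avg σ φ h) := by
  have : StronglyMeasurable (Function.uncurry fun x y => φ x y * h y) :=
    (hφ.meas.mul (hm.comp measurable_snd)).stronglyMeasurable
  exact this.integral_prod_right.measurable

theorem IsSymmDensity.avg_mono (hφ : IsSymmDensity σ φ M) {h g : S → ℝ} {C D : ℝ}
    (hm : Measurable h) (hb : ∀ x, |h x| ≤ C) (gm : Measurable g) (gb : ∀ x, |g x| ≤ D)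
    (hg : ∀ x, h x ≤ g x) (x : S) : avg σ φ h x ≤ avg σ φ g x :=
  integral_mono (hφ.integrable_mul hm hb x) (hφ.integrable_mul gm gb x) fun y =>
    mul_le_mul_of_nonneg_left (hg y) (hφ.nonneg x y)

theorem IsSymmDensity.avg_const (hφ : IsSymmDensity σ φ M) (c : ℝ) (x : S) :
    avg σ φ (fun _ => c) x = c := by
  rw [avg, integral_mul_const, hφ.integral_eq_one, one_mul]

theorem IsSymmDensity.avg_nonneg (hφ : IsSymmDensity σ φ M) {h : S → ℝ} (h0 : ∀ x, 0 ≤ h x)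
    (x : S) : 0 ≤ avg σ φ h x :=
  integral_nonneg fun y => mul_nonneg (hφ.nonneg x y) (h0 y)

theorem IsSymmDensity.abs_avg_le (hφ : IsSymmDensity σ φ M) {h : S → ℝ} {C : ℝ}
    (hm : Measurable h) (hb : ∀ x, |h x| ≤ C) (x : S) : |avg σ φ h x| ≤ C := by
  rw [abs_le]
  constructor
  · rw [← hφ.avg_const (-C) x]
    exact hφ.avg_mono measurable_const (fun _ => le_rfl) hm hb (fun y => (abs_le.1 (hb y)).1) x
  · rw [← hφ.avg_const C x]
    exact hφ.avg_mono hm hb measurable_const (fun _ => le_rfl) (fun y => (abs_le.1 (hb y)).2) x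

theorem IsSymmDensity.integral_mul_avg (hφ : IsSymmDensity σ φ M) {h v : S → ℝ} {C D : ℝ}
    (hm : Measurable h) (hb : ∀ x, |h x| ≤ C) (vm : Measurable v) (vb : ∀ x, |v x| ≤ D) :
    ∫ x, h x * avg σ φ v x ∂σ = ∫ x, avg σ φ h x * v x ∂σ := by
  have hint : Integrable (Function.uncurry fun x y => h x * (φ x y * v y)) (σ.prod σ) := by
    refine integrable_of_measurable_of_bound (C := C * (M * D)) ?_ ?_
    · exact (hm.comp measurable_fst).mul (hφ.meas.mul (vm.comp measurable_snd))
    · rintro ⟨x, y⟩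
      simp only [Function.uncurry, abs_mul]
      have hM := hφ.abs_apply_le x y
      have h0 := abs_nonneg (φ x y)
      have h1 := abs_nonneg (v y)
      have h2 := abs_nonneg (h x)
      exact mul_le_mul (hb x) (mul_le_mul hM (vb y) h1 (h0.trans hM)) (by positivity)
        (h2.trans (hb x))
  calc ∫ x, h x * avg σ φ v x ∂σ = ∫ x, ∫ y, h x * (φ x y * v y) ∂σ ∂σ := by
        simp only [avg, integral_const_mul]
    _ = ∫ y, ∫ x, h x * (φ x y * v y) ∂σ ∂σ := integral_integral_swap hint
    _ = ∫ y, avg σ φ h y * v y ∂σ := by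
        refine integral_congr_ae (Eventually.of_forall fun y => ?_)
        simp only [avg]
        rw [← integral_mul_const]
        refine integral_congr_ae (Eventually.of_forall fun x => ?_)
        simp only [hφ.symm x y]; ring

theorem IsSymmDensity.integral_avg (hφ : IsSymmDensity σ φ M) {h : S → ℝ} {C : ℝ}
    (hm : Measurable h) (hb : ∀ x, |h x| ≤ C) : ∫ x, avg σ φ h x ∂σ = ∫ x, h x ∂σ := by
  have := hφ.integral_mul_avg (measurable_const (a := (1 : ℝ))) (C := 1) (by simp) hm hb
  simp only [one_mul, hφ.avg_const 1] at this
  exact this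

/-- The variance of `u` under the probability density `φ x` is nonnegative, and `φ ≤ M`. This is the
bound of A from L² to L^∞ with norm √M. -/
theorem IsSymmDensity.avg_sq_le (hφ : IsSymmDensity σ φ M) {u : S → ℝ} {C : ℝ}
    (hm : Measurable u) (hb : ∀ x, |u x| ≤ C) (x : S) :
    avg σ φ u x ^ 2 ≤ M * ∫ y, u y ^ 2 ∂σ := by
  set c := avg σ φ u x with hc
  have hb2 : ∀ y, |u y ^ 2| ≤ C ^ 2 := fun y => by
    rw [abs_pow]; exact pow_le_pow_left₀ (abs_nonneg _) (hb y) 2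
  have i2 := hφ.integrable_mul (hm.pow_const 2) hb2 x
  have i1 := hφ.integrable_mul hm hb x
  have h1 : 0 ≤ ∫ y, φ x y * (u y - c) ^ 2 ∂σ :=
    integral_nonneg fun y => mul_nonneg (hφ.nonneg x y) (sq_nonneg _)
  have h2 : ∫ y, φ x y * (u y - c) ^ 2 ∂σ = ∫ y, φ x y * u y ^ 2 ∂σ - c ^ 2 := by
    have : ∀ y, φ x y * (u y - c) ^ 2 =
        1 * (φ x y * u y ^ 2) + (-2 * c) * (φ x y * u y) + c ^ 2 * φ x y := fun y => by ring
    simp only [this]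
    rw [integral_linear_combination i2 i1 (hφ.integrable x), hφ.integral_eq_one]
    change _ + -2 * c * avg σ φ u x + _ = _
    rw [← hc]; ring
  have h3 : ∫ y, φ x y * u y ^ 2 ∂σ ≤ ∫ y, M * u y ^ 2 ∂σ :=
    integral_mono i2 ((integrable_of_measurable_of_bound (hm.pow_const 2) hb2).const_mul M)
      fun y => mul_le_mul_of_nonneg_right (hφ.le x y) (sq_nonneg _)
  rw [integral_const_mul] at h3
  linarith

theorem avg_smul (c : ℝ) (h : S → ℝ) (x : S) :
    avg σ φ (fun y => c * h y) x = c * avg σ φ h x := by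
  simp only [avg, ← integral_const_mul]
  congr 1; ext y; ring

end Avg

theorem rpow_one_add_sub_le {a b K δ : ℝ} (hδ : 0 ≤ δ) (ha : 0 ≤ a) (hab : a ≤ b) (hb : b ≤ K) :
    b ^ (1 + δ) - a ^ (1 + δ) ≤ (1 + δ) * K ^ δ * (b - a) := by
  rcases hab.eq_or_lt with rfl | hlt
  · simp
  obtain ⟨ξ, hξ, h⟩ := exists_hasDerivAt_eq_slope (fun t : ℝ => t ^ (1 + δ))
    (fun t => (1 + δ) * t ^ (1 + δ - 1)) hlt
    ((Real.continuous_rpow_const (by linarith)).continuousOn)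
    (fun t _ => Real.hasDerivAt_rpow_const (Or.inr (by linarith)))
  rw [eq_div_iff (by linarith)] at h
  rw [← h, add_sub_cancel_left]
  have : ξ ^ δ ≤ K ^ δ := Real.rpow_le_rpow (by linarith [hξ.1]) (by linarith [hξ.2]) hδ
  have h1 : 0 ≤ b - a := by linarith
  gcongr

/-- On [0, K] the second derivative of t^(2+δ) is at most (2+δ)(1+δ)K^δ. The mean `m` will be the
centre and √M the bound K. -/
theorem rpow_two_add_le_taylor {m w K δ : ℝ} (hδ : 0 ≤ δ) (hm : 0 ≤ m) (hmK : m ≤ K)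
    (hw : 0 ≤ w) (hwK : w ≤ K) :
    w ^ (2 + δ) ≤ m ^ (2 + δ) + (2 + δ) * m ^ (1 + δ) * (w - m) +
      (2 + δ) * (1 + δ) / 2 * K ^ δ * (w - m) ^ 2 := by
  let F : ℝ → ℝ := fun t => (2 + δ) * m ^ (1 + δ) * (t - m) +
      (2 + δ) * (1 + δ) / 2 * K ^ δ * (t - m) ^ 2 - t ^ (2 + δ)
  let F' : ℝ → ℝ := fun t => (2 + δ) * ((m ^ (1 + δ) - t ^ (1 + δ)) +
    (1 + δ) * K ^ δ * (t - m))
  have hF : ∀ t, HasDerivAt F (F' t) t := by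
    intro t
    have h1 : HasDerivAt (fun t : ℝ => t - m) 1 t := (hasDerivAt_id t).sub_const m
    have h2 := Real.hasDerivAt_rpow_const (x := t) (p := 2 + δ) (Or.inr (by linarith))
    have h3 := ((h1.const_mul ((2 + δ) * m ^ (1 + δ))).add
      ((h1.pow 2).const_mul ((2 + δ) * (1 + δ) / 2 * K ^ δ))).sub h2
    refine h3.congr_deriv ?_
    have : 2 + δ - 1 = 1 + δ := by ring
    rw [this]
    simp only [F']
    norm_num
    ring
  have hc : Continuous F := continuous_iff_continuousAt.2 fun t => (hF t).continuousAt
  -- `F'` has the sign of t - m, by the mean value bound for t^(1+δ), so `F` is smallest at `m`.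
  have key : F m ≤ F w := by
    rcases lt_trichotomy m w with h | h | h
    · obtain ⟨ξ, hξ, he⟩ := exists_hasDerivAt_eq_slope F F' h hc.continuousOn fun t _ => hF t
      rw [eq_div_iff (by linarith)] at he
      have := rpow_one_add_sub_le hδ hm hξ.1.le (hξ.2.le.trans hwK)
      have h0 : 0 ≤ F' ξ := mul_nonneg (by linarith) (by linarith)
      have := mul_nonneg h0 (sub_nonneg.2 h.le)
      linarith
    · rw [h]
    · obtain ⟨ξ, hξ, he⟩ := exists_hasDerivAt_eq_slope F F' h hc.continuousOn fun t _ => hF t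
      rw [eq_div_iff (by linarith)] at he
      have := rpow_one_add_sub_le hδ (hw.trans hξ.1.le) hξ.2.le hmK
      have h0 : 0 ≤ - F' ξ := by
        simp only [F', ← mul_neg]
        exact mul_nonneg (by linarith) (by linarith)
      have := mul_nonneg h0 (sub_nonneg.2 h.le)
      linarith
  simp only [F, sub_self] at key
  norm_num at key
  linarith

/-! ### Hypercontractivity from a variance contraction and a sup bound -/

section Hyper

variable {S : Type*} [MeasurableSpace S] {σ : Measure S} [IsProbabilityMeasure σ]
  {φ : S → S → ℝ} {M : ℝ}

/-- The averaging operator contracts the variance by the factor `lm ^ 2`. -/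
def HasVarianceContraction (σ : Measure S) (φ : S → S → ℝ) (lm : ℝ) : Prop :=
  ∀ (u : S → ℝ) (C : ℝ), Measurable u → (∀ x, |u x| ≤ C) →
    ∫ x, avg σ φ u x ^ 2 ∂σ ≤ (∫ x, u x ∂σ) ^ 2 +
      lm ^ 2 * (∫ x, u x ^ 2 ∂σ - (∫ x, u x ∂σ) ^ 2)

theorem sq_integral_le_integral_sq {u : S → ℝ} {C : ℝ} (hm : Measurable u)
    (hb : ∀ x, |u x| ≤ C) : (∫ x, u x ∂σ) ^ 2 ≤ ∫ x, u x ^ 2 ∂σ := by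
  set c := ∫ x, u x ∂σ with hc
  have i1 := integrable_of_measurable_of_bound (σ := σ) hm hb
  have i2 : Integrable (fun x => u x ^ 2) σ :=
    integrable_of_measurable_of_bound (C := C ^ 2) (hm.pow_const 2) fun y => by
      rw [abs_pow]; exact pow_le_pow_left₀ (abs_nonneg _) (hb y) 2
  have h1 : 0 ≤ ∫ y, (u y - c) ^ 2 ∂σ := integral_nonneg fun y => sq_nonneg _
  have h2 : ∫ y, (u y - c) ^ 2 ∂σ = ∫ y, u y ^ 2 ∂σ - c ^ 2 := by
    have : ∀ y, (u y - c) ^ 2 = 1 * u y ^ 2 + (-2 * c) * u y + c ^ 2 * 1 := fun y => by ring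
    simp only [this]
    rw [integral_linear_combination i2 i1 (integrable_const _), ← hc]
    simp; ring
  linarith

/-- Au takes values in [0, √M] and has the same mean m as u. Integrating the Taylor bound about m
kills the linear term and leaves m^(2+δ) + B · Var(Au), at most m² + B λ² (1 - m²) ≤ 1. -/
theorem IsSymmDensity.integral_avg_rpow_le_of_integral_sq_eq_one (hφ : IsSymmDensity σ φ M)
    {lm δ : ℝ} (hgap : HasVarianceContraction σ φ lm) (hδ : 0 ≤ δ)
    (hB : (2 + δ) * (1 + δ) / 2 * √M ^ δ * lm ^ 2 ≤ 1) {u : S → ℝ} {C : ℝ} (hm : Measurable u)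
    (hb : ∀ x, |u x| ≤ C) (h0 : ∀ x, 0 ≤ u x) (h1 : ∫ x, u x ^ 2 ∂σ = 1) :
    ∫ x, avg σ φ u x ^ (2 + δ) ∂σ ≤ 1 := by
  have hM := hφ.one_le
  have hK : 1 ≤ √M := Real.one_le_sqrt.2 hM
  set K := √M
  set m := ∫ x, u x ∂σ with hmdef
  have hm0 : 0 ≤ m := integral_nonneg h0
  have hm1 : m ^ 2 ≤ 1 := h1 ▸ sq_integral_le_integral_sq hm hb
  have hm1' : m ≤ 1 := by nlinarith
  set w := avg σ φ u with hw
  have hwm : Measurable w := hφ.measurable_avg hm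
  have hwb := hφ.abs_avg_le hm hb
  have hw0 : ∀ x, 0 ≤ w x := hφ.avg_nonneg h0
  have hwK : ∀ x, w x ≤ K := fun x => by
    have := hφ.avg_sq_le hm hb x
    rw [h1, mul_one] at this
    exact Real.le_sqrt_of_sq_le this
  have hgap' := hgap u C hm hb
  rw [h1] at hgap'
  have iw : Integrable w σ := integrable_of_measurable_of_bound hwm hwb
  have iw2 : Integrable (fun x => w x ^ 2) σ :=
    integrable_of_measurable_of_bound (C := C ^ 2) (hwm.pow_const 2) fun y => by
      rw [abs_pow]; exact pow_le_pow_left₀ (abs_nonneg _) (hwb y) 2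
  have hwint : ∫ x, w x ∂σ = m := hφ.integral_avg hm hb
  set A := (2 + δ) * m ^ (1 + δ) with hA
  set B := (2 + δ) * (1 + δ) / 2 * K ^ δ with hBdef
  have hB0 : 0 ≤ B := by positivity
  have hpt : ∀ x, w x ^ (2 + δ) ≤ (m ^ (2 + δ) - A * m + B * m ^ 2) * 1 + (A - 2 * B * m) * w x +
      B * w x ^ 2 := fun x => by
    have := rpow_two_add_le_taylor hδ hm0 (hm1'.trans hK) (hw0 x) (hwK x)
    rw [← hA, ← hBdef] at this
    linarith
  have i1 : Integrable (fun x => w x ^ (2 + δ)) σ := by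
    refine integrable_of_measurable_of_bound (C := K ^ (2 + δ)) (hwm.pow_const _) fun x => ?_
    rw [abs_of_nonneg (Real.rpow_nonneg (hw0 x) _)]
    exact Real.rpow_le_rpow (hw0 x) (hwK x) (by linarith)
  have h2 := integral_mono i1 ((((integrable_const 1).const_mul _).add (iw.const_mul _)).add
    (iw2.const_mul B)) hpt
  have h3 : ∫ x, ((m ^ (2 + δ) - A * m + B * m ^ 2) * 1 + (A - 2 * B * m) * w x +
      B * w x ^ 2) ∂σ = m ^ (2 + δ) - B * m ^ 2 + B * ∫ x, w x ^ 2 ∂σ := by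
    rw [integral_linear_combination (integrable_const _) iw iw2, hwint]
    simp; ring
  have h4 : m ^ (2 + δ) ≤ m ^ 2 := by
    rcases hm0.eq_or_lt with h | h
    · rw [← h, Real.zero_rpow (by linarith)]; simp
    · rw [← Real.rpow_two]
      exact Real.rpow_le_rpow_of_exponent_ge h hm1' (by linarith)
  have h5 : B * ∫ x, w x ^ 2 ∂σ ≤ B * (m ^ 2 + lm ^ 2 * (1 - m ^ 2)) :=
    mul_le_mul_of_nonneg_left hgap' hB0
  have h6 : B * lm ^ 2 * (1 - m ^ 2) ≤ 1 * (1 - m ^ 2) :=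
    mul_le_mul_of_nonneg_right hB (by linarith)
  change ∫ x, w x ^ (2 + δ) ∂σ ≤ _ at h2
  have h7 := h2.trans_eq h3
  linarith

/-- Hypercontractivity from `L²` to `L^(2 + δ)`. -/
theorem IsSymmDensity.integral_avg_rpow_le (hφ : IsSymmDensity σ φ M)
    {lm δ : ℝ} (hgap : HasVarianceContraction σ φ lm) (hδ : 0 ≤ δ)
    (hB : (2 + δ) * (1 + δ) / 2 * √M ^ δ * lm ^ 2 ≤ 1) {u : S → ℝ} {C : ℝ} (hm : Measurable u)
    (hb : ∀ x, |u x| ≤ C) (h0 : ∀ x, 0 ≤ u x) :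
    ∫ x, avg σ φ u x ^ (2 + δ) ∂σ ≤ √(∫ x, u x ^ 2 ∂σ) ^ (2 + δ) := by
  have hI : 0 ≤ ∫ x, u x ^ 2 ∂σ := integral_nonneg fun x => sq_nonneg _
  rcases hI.eq_or_lt with h | h
  · have : ∀ x, avg σ φ u x = 0 := fun x => by
      have := hφ.avg_sq_le hm hb x
      rw [← h, mul_zero] at this
      exact pow_eq_zero_iff (two_ne_zero) |>.1 (le_antisymm this (sq_nonneg _))
    simp only [this, ← h]
    rw [Real.zero_rpow (by linarith)]
    simp [Real.zero_rpow (show 2 + δ ≠ 0 by linarith)]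
  -- Both sides are homogeneous of degree 2 + δ, so `u` may be divided by its L² norm.
  · set N := √(∫ x, u x ^ 2 ∂σ) with hN
    have hN0 : 0 < N := Real.sqrt_pos.2 h
    have hN2 : N ^ 2 = ∫ x, u x ^ 2 ∂σ := Real.sq_sqrt hI
    have := hφ.integral_avg_rpow_le_of_integral_sq_eq_one hgap hδ hB (u := fun x => N⁻¹ * u x)
      (C := N⁻¹ * C) (hm.const_mul _)
      (fun x => by
        rw [abs_mul, abs_of_pos (inv_pos.2 hN0)]
        exact mul_le_mul_of_nonneg_left (hb x) (inv_pos.2 hN0).le)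
      (fun x => mul_nonneg (inv_pos.2 hN0).le (h0 x))
      (by simp only [mul_pow]; rw [integral_const_mul, ← hN2]; field_simp)
    simp only [avg_smul] at this
    have h2 : ∀ x, (N⁻¹ * avg σ φ u x) ^ (2 + δ) = (N ^ (2 + δ))⁻¹ * avg σ φ u x ^ (2 + δ) :=
      fun x => by
        rw [Real.mul_rpow (inv_pos.2 hN0).le (hφ.avg_nonneg h0 x), Real.inv_rpow hN0.le]
    simp only [h2] at this
    rw [integral_const_mul, inv_mul_le_iff₀ (by positivity), mul_one] at this
    exact this

end Hyper

/-! ### Contraction of entropy -/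

/-- The function `t ↦ t log t`. -/
noncomputable def mulLog (t : ℝ) : ℝ := t * Real.log t

@[simp] theorem mulLog_zero : mulLog 0 = 0 := by simp [mulLog]

@[simp] theorem mulLog_one : mulLog 1 = 0 := by simp [mulLog]

theorem measurable_mulLog : Measurable mulLog := measurable_id.mul Real.measurable_log

theorem exists_abs_mulLog_le (C : ℝ) : ∃ D, ∀ t, |t| ≤ C → |mulLog t| ≤ D := by
  obtain ⟨D, hD⟩ := (isCompact_Icc (a := -C) (b := C)).exists_bound_of_continuousOn
    Real.continuous_mul_log.continuousOn
  exact ⟨D, fun t ht => hD t (abs_le.1 ht)⟩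

theorem mulLog_mul {s t : ℝ} : mulLog (s * t) = s * mulLog t + mulLog s * t := by
  rcases eq_or_ne s 0 with rfl | hs
  · simp
  rcases eq_or_ne t 0 with rfl | ht
  · simp
  simp only [mulLog, Real.log_mul hs ht]; ring

/-- Fenchel–Young: t log t - t and e^s are Legendre conjugate. It replaces the variational formula
for entropy throughout. -/
theorem mul_le_mulLog_sub_add_exp {t : ℝ} (ht : 0 ≤ t) (s : ℝ) :
    t * s ≤ mulLog t - t + Real.exp s := by
  rcases ht.eq_or_lt with rfl | h
  · simp [(Real.exp_pos s).le]
  · have h1 := Real.add_one_le_exp (s - Real.log t)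
    rw [Real.exp_sub, Real.exp_log h, le_div_iff₀ h] at h1
    simp only [mulLog]; linarith

section Entropy

variable {S : Type*} [MeasurableSpace S] {σ : Measure S} [IsProbabilityMeasure σ]
  {φ : S → S → ℝ} {M : ℝ}

theorem integrable_mulLog {h : S → ℝ} {C : ℝ} (hm : Measurable h) (hb : ∀ x, |h x| ≤ C) :
    Integrable (fun x => mulLog (h x)) σ := by
  obtain ⟨D, hD⟩ := exists_abs_mulLog_le C
  exact integrable_of_measurable_of_bound (measurable_mulLog.comp hm) fun x => hD _ (hb x)

/-- Jensen's inequality for the logarithm under `φ x`, from the tangent line at the mean c. The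
lower bound `e` keeps the logarithm bounded. -/
theorem IsSymmDensity.exp_avg_log_le (hφ : IsSymmDensity σ φ M) {u : S → ℝ} {C e : ℝ}
    (hm : Measurable u) (he : 0 < e) (h0 : ∀ x, e ≤ u x) (hb : ∀ x, u x ≤ C) (x : S) :
    Real.exp (avg σ φ (fun y => Real.log (u y)) x) ≤ avg σ φ u x := by
  have hb' : ∀ x, |u x| ≤ C := fun x => by
    rw [abs_of_pos (he.trans_le (h0 x))]; exact hb x
  have hlb : ∀ x, |Real.log (u x)| ≤ |Real.log e| + |Real.log C| := fun x => by
    have h1 := Real.log_le_log he (h0 x)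
    have h2 := Real.log_le_log (he.trans_le (h0 x)) (hb x)
    rw [abs_le]
    constructor
    · linarith [neg_abs_le (Real.log e), abs_nonneg (Real.log C)]
    · linarith [le_abs_self (Real.log C), abs_nonneg (Real.log e)]
  set c := avg σ φ u x with hc
  have hc0 : 0 < c := he.trans_le (by
    rw [← hφ.avg_const e x]
    exact hφ.avg_mono measurable_const (fun _ => le_rfl) hm hb' h0 x)
  have hlm : Measurable fun y => Real.log (u y) := Real.measurable_log.comp hm
  have i1 := hφ.integrable_mul hlm hlb x
  have i2 := hφ.integrable_mul hm hb' x
  have hpt : ∀ y, φ x y * Real.log (u y) ≤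
      (Real.log c - 1) * φ x y + c⁻¹ * (φ x y * u y) := fun y => by
    have hu := he.trans_le (h0 y)
    have h1 := Real.log_le_sub_one_of_pos (mul_pos (inv_pos.2 hc0) hu)
    rw [Real.log_mul (inv_pos.2 hc0).ne' hu.ne', Real.log_inv] at h1
    have := mul_le_mul_of_nonneg_left h1 (hφ.nonneg x y)
    linarith
  have h1 := integral_mono i1 (((hφ.integrable x).const_mul _).add (i2.const_mul c⁻¹)) hpt
  have h2 : ∫ y, ((Real.log c - 1) * φ x y + c⁻¹ * (φ x y * u y)) ∂σ = Real.log c := by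
    rw [integral_add ((hφ.integrable x).const_mul _) (i2.const_mul c⁻¹), integral_const_mul,
      integral_const_mul, hφ.integral_eq_one]
    change _ + c⁻¹ * avg σ φ u x = _
    rw [← hc, inv_mul_cancel₀ hc0.ne']; ring
  rw [← Real.le_log_iff_exp_le hc0]
  exact h1.trans_eq h2

/-- Put g = Ah and test h against (2+δ) A(log √g). By self-adjointness the pairing is (2+δ)/2 · ∫ g
log g. By Fenchel–Young it is at most ∫ h log h - 1 + ∫ exp((2+δ) A log √g), and Jensen with
hypercontractivity bounds the last integral by (∫ g)^((2+δ)/2) = 1. -/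
theorem IsSymmDensity.integral_mulLog_avg_le_of_integral_eq_one (hφ : IsSymmDensity σ φ M)
    {lm δ : ℝ} (hgap : HasVarianceContraction σ φ lm) (hδ : 0 ≤ δ)
    (hB : (2 + δ) * (1 + δ) / 2 * √M ^ δ * lm ^ 2 ≤ 1) {h : S → ℝ} {C : ℝ} (hm : Measurable h)
    (hb : ∀ x, |h x| ≤ C) (h0 : ∀ x, 0 ≤ h x) (h1 : ∫ x, h x ∂σ = 1) :
    (2 + δ) / 2 * ∫ x, mulLog (avg σ φ h x) ∂σ ≤ ∫ x, mulLog (h x) ∂σ := by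
  set g := avg σ φ h with hg
  have hgm : Measurable g := hφ.measurable_avg hm
  have hgb := hφ.abs_avg_le hm hb
  have hg0 : ∀ x, 0 ≤ g x := hφ.avg_nonneg h0
  have key : ∀ ε : ℝ, 0 < ε → (2 + δ) / 2 * ∫ x, mulLog (g x) ∂σ ≤
      ∫ x, mulLog (h x) ∂σ - 1 + √(1 + ε) ^ (2 + δ) := by
    intro ε hε
    -- The shift by `ε` bounds the logarithm where g vanishes; it turns the final 1 into
    -- √(1+ε)^(2+δ) and is removed in the limit.
    set u : S → ℝ := fun x => √(g x + ε) with hu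
    have hum : Measurable u := (hgm.add_const ε).sqrt
    have hgε : ∀ x, 0 < g x + ε := fun x => by linarith [hg0 x]
    have hue : ∀ x, √ε ≤ u x := fun x => Real.sqrt_le_sqrt (by linarith [hg0 x])
    have huC : ∀ x, u x ≤ √(C + ε) := fun x =>
      Real.sqrt_le_sqrt (by linarith [(abs_le.1 (hgb x)).2])
    have hε' : 0 < √ε := Real.sqrt_pos.2 hε
    have hu0 : ∀ x, 0 < u x := fun x => hε'.trans_le (hue x)
    have hub : ∀ x, |u x| ≤ √(C + ε) := fun x => by rw [abs_of_pos (hu0 x)]; exact huC x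
    have hlogu : ∀ x, Real.log (u x) = Real.log (g x + ε) / 2 := fun x =>
      Real.log_sqrt (hgε x).le
    set L : S → ℝ := fun x => Real.log (u x) with hL
    have hLm : Measurable L := Real.measurable_log.comp hum
    obtain ⟨D, hLb⟩ : ∃ D, ∀ x, |L x| ≤ D := by
      refine ⟨|Real.log √ε| + |Real.log √(C + ε)|, fun x => ?_⟩
      have h1 := Real.log_le_log hε' (hue x)
      have h2 := Real.log_le_log (hu0 x) (huC x)
      simp only [hL]
      rw [abs_le]
      constructor
      · linarith [neg_abs_le (Real.log √ε), abs_nonneg (Real.log √(C + ε))]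
      · linarith [le_abs_self (Real.log √(C + ε)), abs_nonneg (Real.log √ε)]
    have hexp : ∀ x, Real.exp ((2 + δ) * avg σ φ L x) ≤ avg σ φ u x ^ (2 + δ) := fun x => by
      have h1 := hφ.exp_avg_log_le hum hε' hue huC x
      rw [mul_comm, Real.exp_mul]
      exact Real.rpow_le_rpow (Real.exp_pos _).le h1 (by linarith)
    have hAm := hφ.measurable_avg hLm
    have hAb := hφ.abs_avg_le hLm hLb
    have i1 : Integrable (fun x => h x * ((2 + δ) * avg σ φ L x)) σ := by
      refine integrable_of_measurable_of_bound (C := C * ((2 + δ) * D))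
        (hm.mul (hAm.const_mul _)) fun x => ?_
      rw [abs_mul, abs_mul, abs_of_pos (show 0 < 2 + δ by linarith)]
      exact mul_le_mul (hb x) (mul_le_mul_of_nonneg_left (hAb x) (by linarith)) (by positivity)
        ((abs_nonneg _).trans (hb x))
    have i2 : Integrable (fun x => mulLog (h x)) σ := integrable_mulLog hm hb
    have i3 : Integrable h σ := integrable_of_measurable_of_bound hm hb
    have hau0 : ∀ x, 0 ≤ avg σ φ u x := hφ.avg_nonneg fun x => (hu0 x).le
    have i4 : Integrable (fun x => avg σ φ u x ^ (2 + δ)) σ := by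
      refine integrable_of_measurable_of_bound (C := √(C + ε) ^ (2 + δ))
        ((hφ.measurable_avg hum).pow_const _) fun x => ?_
      rw [abs_of_nonneg (Real.rpow_nonneg (hau0 x) _)]
      exact Real.rpow_le_rpow (hau0 x) ((le_abs_self _).trans (hφ.abs_avg_le hum hub x))
        (by linarith)
    have hY := integral_mono i1 ((i2.sub i3).add i4) fun x =>
      (mul_le_mulLog_sub_add_exp (h0 x) ((2 + δ) * avg σ φ L x)).trans
        (add_le_add_right (hexp x) _)
    simp only [Pi.add_apply, Pi.sub_apply] at hY
    have i23 : Integrable (fun x => mulLog (h x) - h x) σ := i2.sub i3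
    rw [integral_add i23 i4, integral_sub i2 i3, h1] at hY
    have hH := hφ.integral_avg_rpow_le hgap hδ hB hum hub fun x => (hu0 x).le
    have hu2 : ∫ x, u x ^ 2 ∂σ = 1 + ε := by
      have : ∀ x, u x ^ 2 = g x + ε := fun x => Real.sq_sqrt (hgε x).le
      simp only [this]
      rw [integral_add (integrable_of_measurable_of_bound hgm hgb) (integrable_const _),
        hφ.integral_avg hm hb, h1]
      simp
    rw [hu2] at hH
    have hleft : ∫ x, h x * ((2 + δ) * avg σ φ L x) ∂σ = (2 + δ) * ∫ x, g x * L x ∂σ := by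
      have : ∀ x, h x * ((2 + δ) * avg σ φ L x) = (2 + δ) * (h x * avg σ φ L x) :=
        fun x => by ring
      simp only [this]
      rw [integral_const_mul, hφ.integral_mul_avg hm hb hLm hLb]
    have hgL : ∫ x, mulLog (g x) / 2 ∂σ ≤ ∫ x, g x * L x ∂σ := by
      refine integral_mono ((integrable_mulLog hgm hgb).div_const 2)
        (integrable_of_measurable_of_bound (C := C * D) (hgm.mul hLm) fun x => ?_) fun x => ?_
      · rw [abs_mul]
        exact mul_le_mul (hgb x) (hLb x) (abs_nonneg _) ((abs_nonneg _).trans (hgb x))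
      · simp only [hL, hlogu, mulLog]
        rcases (hg0 x).eq_or_lt with h | h
        · rw [← h]; simp
        · have := mul_le_mul_of_nonneg_left
            (Real.log_le_log h (show g x ≤ g x + ε by linarith)) (hg0 x)
          linarith
    rw [integral_div] at hgL
    have := mul_le_mul_of_nonneg_left hgL (show 0 ≤ 2 + δ by linarith)
    rw [hleft] at hY
    linarith
  have hlim : Tendsto (fun ε : ℝ => ∫ x, mulLog (h x) ∂σ - 1 + √(1 + ε) ^ (2 + δ)) (𝓝[>] 0)
      (𝓝 (∫ x, mulLog (h x) ∂σ)) := by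
    have hc : Continuous fun ε : ℝ => ∫ x, mulLog (h x) ∂σ - 1 + √(1 + ε) ^ (2 + δ) :=
      continuous_const.add
        ((Real.continuous_rpow_const (by linarith)).comp (by fun_prop))
    have := hc.tendsto 0
    simp only [add_zero, Real.sqrt_one, Real.one_rpow, sub_add_cancel] at this
    exact this.mono_left nhdsWithin_le_nhds
  exact ge_of_tendsto hlim (eventually_mem_nhdsWithin.mono fun ε hε => key ε hε)

/-- The entropy functional `∫ h log h - (∫ h) log (∫ h)`. -/
noncomputable def entropy (σ : Measure S) (h : S → ℝ) : ℝ :=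
  ∫ x, mulLog (h x) ∂σ - mulLog (∫ x, h x ∂σ)

/-- The averaging operator contracts entropy. -/
theorem IsSymmDensity.entropy_avg_le (hφ : IsSymmDensity σ φ M)
    {lm δ : ℝ} (hgap : HasVarianceContraction σ φ lm) (hδ : 0 ≤ δ)
    (hB : (2 + δ) * (1 + δ) / 2 * √M ^ δ * lm ^ 2 ≤ 1) {h : S → ℝ} {C : ℝ} (hm : Measurable h)
    (hb : ∀ x, |h x| ≤ C) (h0 : ∀ x, 0 ≤ h x) :
    entropy σ (avg σ φ h) ≤ 2 / (2 + δ) * entropy σ h := by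
  have hi : Integrable h σ := integrable_of_measurable_of_bound hm hb
  rw [entropy, entropy, hφ.integral_avg hm hb]
  have hI : 0 ≤ ∫ x, h x ∂σ := integral_nonneg h0
  rcases hI.eq_or_lt with hz | hz
  · have hae : h =ᵐ[σ] 0 := (integral_eq_zero_iff_of_nonneg h0 hi).1 hz.symm
    have h1 : ∀ x, avg σ φ h x = 0 := fun x => by
      rw [avg, ← integral_zero S ℝ (μ := σ)]
      refine integral_congr_ae ?_
      filter_upwards [hae] with y hy
      simp [hy]
    have h2 : ∫ x, mulLog (h x) ∂σ = 0 := by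
      rw [← integral_zero S ℝ (μ := σ)]
      refine integral_congr_ae ?_
      filter_upwards [hae] with y hy
      simp [hy]
    simp [h1, h2, ← hz]
  · set Z := ∫ x, h x ∂σ with hZ
    set v : S → ℝ := fun x => Z⁻¹ * h x with hv
    have hvm : Measurable v := hm.const_mul _
    have hvb : ∀ x, |v x| ≤ Z⁻¹ * C := fun x => by
      rw [abs_mul, abs_of_pos (inv_pos.2 hz)]
      exact mul_le_mul_of_nonneg_left (hb x) (inv_pos.2 hz).le
    have hv1 : ∫ x, v x ∂σ = 1 := by
      rw [integral_const_mul, ← hZ, inv_mul_cancel₀ hz.ne']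
    have key := hφ.integral_mulLog_avg_le_of_integral_eq_one hgap hδ hB hvm hvb
      (fun x => mul_nonneg (inv_pos.2 hz).le (h0 x)) hv1
    -- Entropy is homogeneous of degree 1, which reduces the claim to mean 1.
    have scale : ∀ (w : S → ℝ) (D : ℝ), Measurable w → (∀ x, |w x| ≤ D) →
        ∫ x, w x ∂σ = 1 → ∫ x, mulLog (Z * w x) ∂σ - mulLog Z = Z * ∫ x, mulLog (w x) ∂σ := by
      intro w D wm wb w1
      simp only [mulLog_mul]
      rw [integral_add ((integrable_mulLog wm wb).const_mul _)
        ((integrable_of_measurable_of_bound wm wb).const_mul _), integral_const_mul,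
        integral_const_mul, w1]
      ring
    have hh : ∀ x, h x = Z * v x := fun x => by simp [hv, hz.ne']
    have e1 := scale v _ hvm hvb hv1
    have e2 := scale (avg σ φ v) _ (hφ.measurable_avg hvm) (hφ.abs_avg_le hvm hvb)
      ((hφ.integral_avg hvm hvb).trans hv1)
    have e3 : ∀ x, avg σ φ h x = Z * avg σ φ v x := fun x => by
      simp only [hv, avg_smul]
      rw [← mul_assoc, mul_inv_cancel₀ hz.ne', one_mul]
    simp only [e3]
    rw [e2]
    have e4 : ∫ x, mulLog (h x) ∂σ = ∫ x, mulLog (Z * v x) ∂σ :=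
      integral_congr_ae (Eventually.of_forall fun x => by simp only [← hh])
    rw [e4, e1, div_mul_eq_mul_div, le_div_iff₀ (by linarith)]
    nlinarith

end Entropy

/-! ### Likelihoods and mutual information -/

section Block

variable {S : Type*} [MeasurableSpace S] {σ : Measure S} [IsProbabilityMeasure σ]
  {ι : Type*} [Fintype ι]

/-- Disjoint blocks of coordinates are independent under a product measure, and each function
factors through its block: the missing coordinates are filled with an arbitrary point `s`. -/
theorem indepFun_of_dependsOn {A B : Set ι} (hAB : Disjoint A B) {f g : (ι → S) → ℝ}
    (hf : Measurable f) (hg : Measurable g) (hfA : DependsOn f A) (hgB : DependsOn g B) :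
    IndepFun f g (Measure.pi fun _ => σ) := by
  classical
  obtain ⟨s⟩ := nonempty_of_isProbabilityMeasure σ
  have hind : iIndepFun (fun (i : ι) (y : ι → S) => y i) (Measure.pi fun _ => σ) :=
    iIndepFun_pi (X := fun _ (z : S) => z) fun _ => aemeasurable_id
  have hd : Disjoint A.toFinset B.toFinset := by simpa using hAB
  have h1 := hind.indepFun_finset A.toFinset B.toFinset hd fun i => measurable_pi_apply i
  have ext_meas : ∀ T : Finset ι, Measurable fun (z : T → S) (i : ι) =>
      if h : i ∈ T then z ⟨i, h⟩ else s := fun T => by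
    refine measurable_pi_lambda _ fun i => ?_
    by_cases h : i ∈ T
    · simp only [h, dif_pos]; exact measurable_pi_apply _
    · simp only [h, dif_neg, not_false_eq_true]; exact measurable_const
  have h2 := h1.comp (hf.comp (ext_meas A.toFinset)) (hg.comp (ext_meas B.toFinset))
  convert h2 using 1
  · ext y
    refine hfA fun i hi => ?_
    simp [hi]
  · ext y
    refine hgB fun i hi => ?_
    simp [hi]

theorem integral_mul_of_dependsOn {A B : Set ι} (hAB : Disjoint A B) {f g : (ι → S) → ℝ}
    (hf : Measurable f) (hg : Measurable g) (hfA : DependsOn f A) (hgB : DependsOn g B) :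
    ∫ y, f y * g y ∂(Measure.pi fun _ : ι => σ) =
      (∫ y, f y ∂(Measure.pi fun _ : ι => σ)) * ∫ y, g y ∂(Measure.pi fun _ : ι => σ) :=
  (indepFun_of_dependsOn hAB hf hg hfA hgB).integral_fun_mul_eq_mul_integral
    hf.aestronglyMeasurable hg.aestronglyMeasurable

/-- A bounded transition density from `S` to `ι → S`, with respect to the product measure, that
depends only on the coordinates in `A`. -/
structure IsLikelihood (σ : Measure S) (A : Set ι) (a : S → (ι → S) → ℝ) : Prop where
  meas : Measurable (Function.uncurry a)
  nonneg : ∀ x y, 0 ≤ a x y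
  bound : ∃ D, ∀ x y, a x y ≤ D
  dep : ∀ x, DependsOn (a x) A
  integral_eq_one : ∀ x, ∫ y, a x y ∂(Measure.pi fun _ => σ) = 1

/-- The mutual information between a `σ`-distributed label and an observation with transition
density `a`. -/
noncomputable def info (σ : Measure S) (a : S → (ι → S) → ℝ) : ℝ :=
  ∫ y, entropy σ (fun x => a x y) ∂(Measure.pi fun _ => σ)

variable {A B : Set ι} {a b : S → (ι → S) → ℝ}

theorem IsLikelihood.exists_abs_le (ha : IsLikelihood σ A a) : ∃ D, ∀ x y, |a x y| ≤ D := by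
  obtain ⟨D, hD⟩ := ha.bound
  exact ⟨D, fun x y => by rw [abs_of_nonneg (ha.nonneg x y)]; exact hD x y⟩

theorem IsLikelihood.measurable_left (ha : IsLikelihood σ A a) (y : ι → S) :
    Measurable fun x => a x y :=
  ha.meas.comp measurable_prodMk_right

theorem IsLikelihood.measurable_right (ha : IsLikelihood σ A a) (x : S) : Measurable (a x) :=
  ha.meas.comp measurable_prodMk_left

theorem IsLikelihood.integrable_left (ha : IsLikelihood σ A a) (y : ι → S) :
    Integrable (fun x => a x y) σ := by
  obtain ⟨D, hD⟩ := ha.exists_abs_le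
  exact integrable_of_measurable_of_bound (ha.measurable_left y) fun x => hD x y

theorem measurable_integral_left {k : S → (ι → S) → ℝ} (hk : Measurable (Function.uncurry k)) :
    Measurable fun y => ∫ x, k x y ∂σ := by
  have : StronglyMeasurable (Function.uncurry fun y x => k x y) :=
    (hk.comp measurable_swap).stronglyMeasurable
  exact this.integral_prod_right.measurable

theorem integral_swap_of_bound {k : S → (ι → S) → ℝ} {D : ℝ} (hk : Measurable (Function.uncurry k))
    (hD : ∀ x y, |k x y| ≤ D) :
    ∫ y, ∫ x, k x y ∂σ ∂(Measure.pi fun _ : ι => σ) =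
      ∫ x, ∫ y, k x y ∂(Measure.pi fun _ : ι => σ) ∂σ :=
  (integral_integral_swap (integrable_of_measurable_of_bound hk fun p => hD p.1 p.2)).symm

theorem abs_integral_le_of_bound {k : S → ℝ} {D : ℝ} (hD : ∀ x, |k x| ≤ D) :
    |∫ x, k x ∂σ| ≤ D := by
  have := norm_integral_le_of_norm_le_const (μ := σ) (f := k) (C := D) (Eventually.of_forall hD)
  simpa using this

/-- The marginal density of the observation. -/
noncomputable def evidence (σ : Measure S) (a : S → (ι → S) → ℝ) (y : ι → S) : ℝ :=
  ∫ x, a x y ∂σ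

theorem IsLikelihood.measurable_evidence (ha : IsLikelihood σ A a) : Measurable (evidence σ a) :=
  measurable_integral_left ha.meas

theorem IsLikelihood.evidence_nonneg (ha : IsLikelihood σ A a) (y : ι → S) : 0 ≤ evidence σ a y :=
  integral_nonneg fun x => ha.nonneg x y

theorem IsLikelihood.dependsOn_evidence (ha : IsLikelihood σ A a) :
    DependsOn (evidence σ a) A := fun _ _ h =>
  integral_congr_ae (Eventually.of_forall fun x => ha.dep x h)

theorem IsLikelihood.integral_evidence (ha : IsLikelihood σ A a) :
    ∫ y, evidence σ a y ∂(Measure.pi fun _ => σ) = 1 := by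
  obtain ⟨D, hD⟩ := ha.exists_abs_le
  simp only [evidence]
  rw [integral_swap_of_bound ha.meas hD]
  simp [ha.integral_eq_one]

/-- Fubini. The first term is exactly additive for conditionally independent observations, so
subadditivity becomes a statement about the evidence alone. -/
theorem IsLikelihood.info_eq (ha : IsLikelihood σ A a) :
    info σ a = ∫ x, ∫ y, mulLog (a x y) ∂(Measure.pi fun _ => σ) ∂σ -
      ∫ y, mulLog (evidence σ a y) ∂(Measure.pi fun _ => σ) := by
  obtain ⟨D, hD⟩ := ha.exists_abs_le
  obtain ⟨E, hE⟩ := exists_abs_mulLog_le D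
  have hm : Measurable (Function.uncurry fun x y => mulLog (a x y)) :=
    measurable_mulLog.comp ha.meas
  rw [← integral_swap_of_bound hm fun x y => hE _ (hD x y)]
  simp only [info, entropy]
  refine integral_sub ?_ ?_
  · exact integrable_of_measurable_of_bound (measurable_integral_left hm)
      fun y => abs_integral_le_of_bound fun x => hE _ (hD x y)
  · exact integrable_mulLog ha.measurable_evidence
      fun y => abs_integral_le_of_bound fun x => hD x y

theorem IsLikelihood.mul (ha : IsLikelihood σ A a) (hb : IsLikelihood σ B b)
    (hAB : Disjoint A B) : IsLikelihood σ (A ∪ B) fun x y => a x y * b x y := by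
  obtain ⟨D, hD⟩ := ha.bound
  obtain ⟨E, hE⟩ := hb.bound
  refine ⟨ha.meas.mul hb.meas, fun x y => mul_nonneg (ha.nonneg x y) (hb.nonneg x y),
    ⟨D * E, fun x y => mul_le_mul (hD x y) (hE x y) (hb.nonneg x y)
      ((ha.nonneg x y).trans (hD x y))⟩, fun x y z h => ?_, fun x => ?_⟩
  · rw [ha.dep x fun i hi => h i (Or.inl hi), hb.dep x fun i hi => h i (Or.inr hi)]
  · rw [integral_mul_of_dependsOn hAB (ha.measurable_right x) (hb.measurable_right x) (ha.dep x)
      (hb.dep x), ha.integral_eq_one, hb.integral_eq_one, one_mul]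

theorem isLikelihood_one : IsLikelihood σ (∅ : Set ι) fun _ _ => 1 :=
  ⟨measurable_const, fun _ _ => zero_le_one, ⟨1, fun _ _ => le_rfl⟩, fun _ _ _ _ => rfl,
    fun _ => by simp⟩

theorem info_one : info σ (fun (_ : S) (_ : ι → S) => (1 : ℝ)) = 0 := by
  simp [info, entropy]

/-- Integrating out the coordinates in `B` marginalises the joint evidence to the evidence of `a`,
so the right side equals ∫ Z log(Z + ε) with Z that evidence. -/
theorem IsLikelihood.mulLog_evidence_le (ha : IsLikelihood σ A a) (hb : IsLikelihood σ B b)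
    (hAB : Disjoint A B) {ε : ℝ} (hε : 0 < ε) :
    ∫ y, mulLog (evidence σ a y) ∂(Measure.pi fun _ => σ) ≤
      ∫ y, evidence σ (fun x y => a x y * b x y) y * Real.log (evidence σ a y + ε)
        ∂(Measure.pi fun _ => σ) := by
  obtain ⟨D, hD⟩ := ha.exists_abs_le
  obtain ⟨E, hE⟩ := hb.exists_abs_le
  have hZb : ∀ y, |evidence σ a y| ≤ D := fun y => abs_integral_le_of_bound fun x => hD x y
  have hZ0 := ha.evidence_nonneg
  have hlm : Measurable fun y => Real.log (evidence σ a y + ε) :=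
    Real.measurable_log.comp (ha.measurable_evidence.add_const ε)
  obtain ⟨L, hL⟩ : ∃ L, ∀ y, |Real.log (evidence σ a y + ε)| ≤ L := by
    refine ⟨|Real.log ε| + |Real.log (D + ε)|, fun y => ?_⟩
    have h1 := Real.log_le_log hε (show ε ≤ evidence σ a y + ε by linarith [hZ0 y])
    have h2 := Real.log_le_log (show 0 < evidence σ a y + ε by linarith [hZ0 y])
      (show evidence σ a y + ε ≤ D + ε by linarith [(abs_le.1 (hZb y)).2])
    rw [abs_le]
    constructor
    · linarith [neg_abs_le (Real.log ε), abs_nonneg (Real.log (D + ε))]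
    · linarith [le_abs_self (Real.log (D + ε)), abs_nonneg (Real.log ε)]
  have haL : ∀ x y, |a x y * Real.log (evidence σ a y + ε)| ≤ D * L := fun x y => by
    rw [abs_mul]
    exact mul_le_mul (hD x y) (hL y) (abs_nonneg _) ((abs_nonneg _).trans (hD x y))
  have haLm : Measurable (Function.uncurry fun x y => a x y * Real.log (evidence σ a y + ε)) :=
    ha.meas.mul (hlm.comp measurable_snd)
  have h1 : ∫ y, evidence σ (fun x y => a x y * b x y) y * Real.log (evidence σ a y + ε)
      ∂(Measure.pi fun _ => σ) =
      ∫ x, ∫ y, a x y * Real.log (evidence σ a y + ε) * b x y ∂(Measure.pi fun _ => σ) ∂σ := by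
    rw [← integral_swap_of_bound (D := D * L * E) (haLm.mul hb.meas)]
    · refine integral_congr_ae (Eventually.of_forall fun y => ?_)
      simp only [evidence]
      rw [← integral_mul_const]
      refine integral_congr_ae (Eventually.of_forall fun x => ?_)
      simp only; ring
    · intro x y
      rw [abs_mul]
      exact mul_le_mul (haL x y) (hE x y) (abs_nonneg _) ((abs_nonneg _).trans (haL x y))
  have h2 : ∀ x, ∫ y, a x y * Real.log (evidence σ a y + ε) * b x y ∂(Measure.pi fun _ => σ) =
      ∫ y, a x y * Real.log (evidence σ a y + ε) ∂(Measure.pi fun _ => σ) := fun x => by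
    rw [integral_mul_of_dependsOn (f := fun y => a x y * Real.log (evidence σ a y + ε)) hAB
      ((ha.measurable_right x).mul hlm) (hb.measurable_right x) _ (hb.dep x), hb.integral_eq_one,
      mul_one]
    intro y z h
    simp only
    rw [ha.dep x h, ha.dependsOn_evidence h]
  simp only [h1, h2]
  rw [← integral_swap_of_bound haLm haL]
  have h3 : ∀ y, ∫ x, a x y * Real.log (evidence σ a y + ε) ∂σ =
      evidence σ a y * Real.log (evidence σ a y + ε) := fun y => integral_mul_const _ _
  simp only [h3]
  refine integral_mono (integrable_mulLog ha.measurable_evidence hZb)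
    (integrable_of_measurable_of_bound (C := D * L) (ha.measurable_evidence.mul hlm) fun y => ?_)
    fun y => ?_
  · rw [abs_mul]
    exact mul_le_mul (hZb y) (hL y) (abs_nonneg _) ((abs_nonneg _).trans (hZb y))
  · rcases (hZ0 y).eq_or_lt with h | h
    · rw [← h]; simp
    · exact mul_le_mul_of_nonneg_left (Real.log_le_log h (by linarith)) h.le

/-- Mutual information is subadditive over conditionally independent observations. -/
theorem IsLikelihood.info_mul_le (ha : IsLikelihood σ A a) (hb : IsLikelihood σ B b)
    (hAB : Disjoint A B) : info σ (fun x y => a x y * b x y) ≤ info σ a + info σ b := by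
  set p : S → (ι → S) → ℝ := fun x y => a x y * b x y with hp
  have hpL : IsLikelihood σ (A ∪ B) p := ha.mul hb hAB
  have hp' : p = fun x y => b x y * a x y := by ext x y; simp only [hp]; ring
  obtain ⟨D, hD⟩ := ha.exists_abs_le
  obtain ⟨E, hE⟩ := hb.exists_abs_le
  obtain ⟨F, hF⟩ := hpL.exists_abs_le
  obtain ⟨D', hD'⟩ := exists_abs_mulLog_le D
  obtain ⟨E', hE'⟩ := exists_abs_mulLog_le E
  rw [ha.info_eq, hb.info_eq, hpL.info_eq]
  have hma : Measurable (Function.uncurry fun x y => mulLog (a x y)) :=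
    measurable_mulLog.comp ha.meas
  have hmb : Measurable (Function.uncurry fun x y => mulLog (b x y)) :=
    measurable_mulLog.comp hb.meas
  have hmax : ∀ x, Measurable fun y => mulLog (a x y) := fun x =>
    measurable_mulLog.comp (ha.measurable_right x)
  have hmbx : ∀ x, Measurable fun y => mulLog (b x y) := fun x =>
    measurable_mulLog.comp (hb.measurable_right x)
  -- Given the label `x`, the two observations are independent, so their entropies add.
  have hfst : ∀ x, ∫ y, mulLog (p x y) ∂(Measure.pi fun _ => σ) =
      ∫ y, mulLog (a x y) ∂(Measure.pi fun _ => σ) +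
        ∫ y, mulLog (b x y) ∂(Measure.pi fun _ => σ) := fun x => by
    simp only [hp, mulLog_mul]
    rw [integral_add, integral_mul_of_dependsOn hAB (ha.measurable_right x) (hmbx x) (ha.dep x),
      integral_mul_of_dependsOn hAB (hmax x) (hb.measurable_right x) _ (hb.dep x),
      ha.integral_eq_one, hb.integral_eq_one]
    · ring
    · intro y z h; simp only; rw [ha.dep x h]
    · intro y z h; simp only; rw [hb.dep x h]
    · refine integrable_of_measurable_of_bound (C := D * E')
        ((ha.measurable_right x).mul (hmbx x)) fun y => ?_
      rw [abs_mul]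
      exact mul_le_mul (hD x y) (hE' _ (hE x y)) (abs_nonneg _) ((abs_nonneg _).trans (hD x y))
    · refine integrable_of_measurable_of_bound (C := D' * E)
        ((hmax x).mul (hb.measurable_right x)) fun y => ?_
      rw [abs_mul]
      exact mul_le_mul (hD' _ (hD x y)) (hE x y) (abs_nonneg _)
        ((abs_nonneg _).trans (hD' _ (hD x y)))
  have hmeas_int : ∀ k : S → (ι → S) → ℝ, Measurable (Function.uncurry k) →
      Measurable fun x => ∫ y, k x y ∂(Measure.pi fun _ => σ) := fun k hk =>
    hk.stronglyMeasurable.integral_prod_right.measurable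
  have hfst' : ∫ x, ∫ y, mulLog (p x y) ∂(Measure.pi fun _ => σ) ∂σ =
      ∫ x, ∫ y, mulLog (a x y) ∂(Measure.pi fun _ => σ) ∂σ +
      ∫ x, ∫ y, mulLog (b x y) ∂(Measure.pi fun _ => σ) ∂σ := by
    simp only [hfst]
    exact integral_add
      (integrable_of_measurable_of_bound (hmeas_int _ hma)
        fun x => abs_integral_le_of_bound fun y => hD' _ (hD x y))
      (integrable_of_measurable_of_bound (hmeas_int _ hmb)
        fun x => abs_integral_le_of_bound fun y => hE' _ (hE x y))
  have hZa : ∀ y, |evidence σ a y| ≤ D := fun y => abs_integral_le_of_bound fun x => hD x y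
  have hZb : ∀ y, |evidence σ b y| ≤ E := fun y => abs_integral_le_of_bound fun x => hE x y
  have hZp : ∀ y, |evidence σ p y| ≤ F := fun y => abs_integral_le_of_bound fun x => hF x y
  -- The relative entropy of the joint evidence with respect to the product of the two marginal
  -- evidences is nonnegative. The shift by ε costs the mass (1+ε)² in place of 1.
  have key : ∀ ε : ℝ, 0 < ε →
      ∫ y, mulLog (evidence σ a y) ∂(Measure.pi fun _ => σ) +
        ∫ y, mulLog (evidence σ b y) ∂(Measure.pi fun _ => σ) ≤
      ∫ y, mulLog (evidence σ p y) ∂(Measure.pi fun _ => σ) - 1 + (1 + ε) * (1 + ε) := by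
    intro ε hε
    have h1 := ha.mulLog_evidence_le hb hAB hε
    have h2 := hb.mulLog_evidence_le ha hAB.symm hε
    rw [← hp'] at h2
    rw [← hp] at h1
    have log_bound : ∀ {Z : (ι → S) → ℝ} {C : ℝ}, (∀ y, 0 ≤ Z y) → (∀ y, |Z y| ≤ C) →
        ∃ L, ∀ y, |Real.log (Z y + ε)| ≤ L := by
      intro Z C hZ0 hZC
      refine ⟨|Real.log ε| + |Real.log (C + ε)|, fun y => ?_⟩
      have h1 := Real.log_le_log hε (show ε ≤ Z y + ε by linarith [hZ0 y])
      have h2 := Real.log_le_log (show 0 < Z y + ε by linarith [hZ0 y])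
        (show Z y + ε ≤ C + ε by linarith [(abs_le.1 (hZC y)).2])
      rw [abs_le]
      constructor
      · linarith [neg_abs_le (Real.log ε), abs_nonneg (Real.log (C + ε))]
      · linarith [le_abs_self (Real.log (C + ε)), abs_nonneg (Real.log ε)]
    obtain ⟨La, hLa⟩ := log_bound ha.evidence_nonneg hZa
    obtain ⟨Lb, hLb⟩ := log_bound hb.evidence_nonneg hZb
    have int_log : ∀ {Z : (ι → S) → ℝ} {L : ℝ}, Measurable Z →
        (∀ y, |Real.log (Z y + ε)| ≤ L) →
        Integrable (fun y => evidence σ p y * Real.log (Z y + ε)) (Measure.pi fun _ => σ) := by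
      intro Z L hZ hL
      refine integrable_of_measurable_of_bound (C := F * L) (hpL.measurable_evidence.mul
        (Real.measurable_log.comp (hZ.add_const ε))) fun y => ?_
      rw [abs_mul]
      exact mul_le_mul (hZp y) (hL y) (abs_nonneg _) ((abs_nonneg _).trans (hZp y))
    have ia := int_log ha.measurable_evidence hLa
    have ib := int_log hb.measurable_evidence hLb
    have ip : Integrable (evidence σ p) (Measure.pi fun _ => σ) :=
      integrable_of_measurable_of_bound hpL.measurable_evidence hZp
    have iml : Integrable (fun y => mulLog (evidence σ p y)) (Measure.pi fun _ => σ) :=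
      integrable_mulLog hpL.measurable_evidence hZp
    have iZa : Integrable (evidence σ a) (Measure.pi fun _ => σ) :=
      integrable_of_measurable_of_bound ha.measurable_evidence hZa
    have iZb : Integrable (evidence σ b) (Measure.pi fun _ => σ) :=
      integrable_of_measurable_of_bound hb.measurable_evidence hZb
    have iprod : Integrable (fun y => (evidence σ a y + ε) * (evidence σ b y + ε))
        (Measure.pi fun _ => σ) := by
      refine integrable_of_measurable_of_bound (C := (D + ε) * (E + ε))
        ((ha.measurable_evidence.add_const ε).mul (hb.measurable_evidence.add_const ε))
        fun y => ?_
      have a0 := ha.evidence_nonneg y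
      have b0 := hb.evidence_nonneg y
      rw [abs_of_nonneg (by positivity)]
      exact mul_le_mul (by linarith [(abs_le.1 (hZa y)).2]) (by linarith [(abs_le.1 (hZb y)).2])
        (by linarith) (by linarith [(abs_le.1 (hZa y)).2])
    -- Fenchel–Young at t = joint evidence and s = the sum of the two shifted log evidences.
    have hY := integral_mono (ia.add ib) ((iml.sub ip).add iprod) fun y => by
      have a0 : 0 < evidence σ a y + ε := by linarith [ha.evidence_nonneg y]
      have b0 : 0 < evidence σ b y + ε := by linarith [hb.evidence_nonneg y]
      have := mul_le_mulLog_sub_add_exp (hpL.evidence_nonneg y)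
        (Real.log (evidence σ a y + ε) + Real.log (evidence σ b y + ε))
      rw [Real.exp_add, Real.exp_log a0, Real.exp_log b0, mul_add] at this
      exact this
    rw [integral_add' ia ib, integral_add' (iml.sub ip) iprod, integral_sub' iml ip,
      hpL.integral_evidence, integral_mul_of_dependsOn hAB (ha.measurable_evidence.add_const ε)
        (hb.measurable_evidence.add_const ε), integral_add iZa (integrable_const _),
      integral_add iZb (integrable_const _), ha.integral_evidence, hb.integral_evidence] at hY
    · simp only [integral_const, probReal_univ, one_smul] at hY
      linarith
    · intro y z h; simp only; rw [ha.dependsOn_evidence h]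
    · intro y z h; simp only; rw [hb.dependsOn_evidence h]
  have hlim : Tendsto (fun ε : ℝ => ∫ y, mulLog (evidence σ p y) ∂(Measure.pi fun _ => σ) - 1 +
      (1 + ε) * (1 + ε)) (𝓝[>] 0) (𝓝 (∫ y, mulLog (evidence σ p y) ∂(Measure.pi fun _ => σ))) := by
    have hc : Continuous fun ε : ℝ => ∫ y, mulLog (evidence σ p y) ∂(Measure.pi fun _ => σ) - 1 +
      (1 + ε) * (1 + ε) := by fun_prop
    have := hc.tendsto 0
    simp only [add_zero, mul_one, sub_add_cancel] at this
    exact this.mono_left nhdsWithin_le_nhds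
  have := ge_of_tendsto hlim (eventually_mem_nhdsWithin.mono fun ε hε => key ε hε)
  rw [hfst']
  linarith

/-- The fibres of `anc` are disjoint, so the two-factor statements can be iterated. In the tree,
`anc` sends an observed vertex to its ancestor at a given depth. -/
theorem IsLikelihood.prod {κ : Type*} {anc : ι → κ} {a : κ → S → (ι → S) → ℝ}
    (ha : ∀ u, IsLikelihood σ {i | anc i = u} (a u)) (s : Finset κ) :
    IsLikelihood σ {i | anc i ∈ s} (fun x y => ∏ u ∈ s, a u x y) ∧
      info σ (fun x y => ∏ u ∈ s, a u x y) ≤ ∑ u ∈ s, info σ (a u) := by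
  induction s using Finset.cons_induction with
  | empty =>
    simp only [Finset.prod_empty, Finset.sum_empty, info_one, le_refl, and_true, Finset.notMem_empty]
    exact isLikelihood_one
  | cons u s hu ih =>
    have hd : Disjoint {i | anc i = u} {i | anc i ∈ s} := by
      rw [Set.disjoint_left]
      rintro i rfl hi
      exact hu hi
    simp only [Finset.prod_cons, Finset.sum_cons, Finset.mem_cons]
    exact ⟨(ha u).mul ih.1 hd, ((ha u).info_mul_le ih.1 hd).trans (by linarith [ih.2])⟩

variable {φ : S → S → ℝ} {M : ℝ}

theorem IsSymmDensity.measurable_uncurry_avg (hφ : IsSymmDensity σ φ M)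
    (ha : IsLikelihood σ A a) :
    Measurable (Function.uncurry fun x y => avg σ φ (fun z => a z y) x) := by
  have : StronglyMeasurable
      (Function.uncurry fun (p : S × (ι → S)) z => φ p.1 z * a z p.2) := by
    refine Measurable.stronglyMeasurable ?_
    refine Measurable.mul ?_ ?_
    · exact hφ.meas.comp ((measurable_fst.comp measurable_fst).prodMk measurable_snd)
    · exact ha.meas.comp (measurable_snd.prodMk (measurable_snd.comp measurable_fst))
  exact this.integral_prod_right.measurable

/-- Averaging in the label moves an observation one edge up: it gives the likelihood in terms of the
label of the parent. -/
theorem IsLikelihood.avg (hφ : IsSymmDensity σ φ M) (ha : IsLikelihood σ A a) :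
    IsLikelihood σ A fun x y => _root_.avg σ φ (fun z => a z y) x := by
  obtain ⟨D, hD⟩ := ha.exists_abs_le
  refine ⟨hφ.measurable_uncurry_avg ha, fun x y => hφ.avg_nonneg (fun z => ha.nonneg z y) x,
    ⟨D, fun x y => (le_abs_self _).trans
      (hφ.abs_avg_le (ha.measurable_left y) (fun z => hD z y) x)⟩, fun x y z h => ?_, fun x => ?_⟩
  · simp only [_root_.avg]
    exact integral_congr_ae (Eventually.of_forall fun w => by simp only [ha.dep w h])
  · simp only [_root_.avg]
    rw [integral_swap_of_bound (k := fun z y => φ x z * a z y) (D := M * D)]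
    · simp only [integral_const_mul, ha.integral_eq_one, mul_one, hφ.integral_eq_one]
    · exact ((hφ.measurable_right x).comp measurable_fst).mul ha.meas
    · intro z y
      rw [abs_mul]
      exact mul_le_mul (hφ.abs_apply_le x z) (hD z y) (abs_nonneg _)
        ((abs_nonneg _).trans (hφ.abs_apply_le x z))

theorem IsLikelihood.integrable_entropy (ha : IsLikelihood σ A a) :
    Integrable (fun y => entropy σ fun x => a x y) (Measure.pi fun _ : ι => σ) := by
  obtain ⟨D, hD⟩ := ha.exists_abs_le
  obtain ⟨E, hE⟩ := exists_abs_mulLog_le D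
  refine Integrable.sub ?_ ?_
  · exact integrable_of_measurable_of_bound
      (measurable_integral_left (k := fun x y => mulLog (a x y)) (measurable_mulLog.comp ha.meas))
      fun y => abs_integral_le_of_bound fun x => hE _ (hD x y)
  · exact integrable_mulLog ha.measurable_evidence
      fun y => abs_integral_le_of_bound fun x => hD x y

/-- Strong data processing inequality for mutual information. -/
theorem IsLikelihood.info_avg_le (hφ : IsSymmDensity σ φ M) {lm δ : ℝ}
    (hgap : HasVarianceContraction σ φ lm) (hδ : 0 ≤ δ)
    (hB : (2 + δ) * (1 + δ) / 2 * √M ^ δ * lm ^ 2 ≤ 1) (ha : IsLikelihood σ A a) :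
    info σ (fun x y => _root_.avg σ φ (fun z => a z y) x) ≤ 2 / (2 + δ) * info σ a := by
  obtain ⟨D, hD⟩ := ha.exists_abs_le
  rw [info, info, ← integral_const_mul]
  refine integral_mono (ha.avg hφ).integrable_entropy (ha.integrable_entropy.const_mul _)
    fun y => ?_
  exact hφ.entropy_avg_le hgap hδ hB (ha.measurable_left y) (fun x => hD x y)
    fun x => ha.nonneg x y

theorem IsSymmDensity.isLikelihood_apply (hφ : IsSymmDensity σ φ M) (i : ι) :
    IsLikelihood σ {j | j = i} fun x y => φ x (y i) := by
  refine ⟨hφ.meas.comp (measurable_fst.prodMk ((measurable_pi_apply i).comp measurable_snd)),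
    fun x y => hφ.nonneg _ _, ⟨M, fun x y => hφ.le _ _⟩, fun x y z h => ?_, fun x => ?_⟩
  · simp only [h i rfl]
  · rw [integral_comp_eval (μ := fun _ : ι => σ) (f := φ x)
      (hφ.measurable_right x).aestronglyMeasurable, hφ.integral_eq_one]

/-- By symmetry `φ · (y i)` has mean 1, and a density bounded by `M` has entropy at most log M. This
starts the induction on depth with a finite cost per observed vertex. -/
theorem IsSymmDensity.info_apply_le (hφ : IsSymmDensity σ φ M) (i : ι) :
    info σ (fun x (y : ι → S) => φ x (y i)) ≤ Real.log M := by
  have hpt : ∀ y : ι → S, entropy σ (fun x => φ x (y i)) ≤ Real.log M := fun y => by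
    have h1 : ∫ x, φ x (y i) ∂σ = 1 := by
      simp only [hφ.symm _ (y i), hφ.integral_eq_one]
    rw [entropy, h1, mulLog_one, sub_zero]
    have i1 : Integrable (fun x => φ x (y i)) σ := by
      simp only [hφ.symm _ (y i)]; exact hφ.integrable _
    calc ∫ x, mulLog (φ x (y i)) ∂σ ≤ ∫ x, φ x (y i) * Real.log M ∂σ := by
          refine integral_mono (integrable_mulLog ?_ fun x => hφ.abs_apply_le x (y i))
            (i1.mul_const _) fun x => ?_
          · exact hφ.meas.comp measurable_prodMk_right
          · rcases (hφ.nonneg x (y i)).eq_or_lt with h | h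
            · simp only [← h]; simp
            · exact mul_le_mul_of_nonneg_left (Real.log_le_log h (hφ.le _ _)) h.le
      _ = Real.log M := by rw [integral_mul_const, h1, one_mul]
  calc info σ (fun x (y : ι → S) => φ x (y i)) ≤ ∫ _, Real.log M ∂(Measure.pi fun _ : ι => σ) :=
        integral_mono (hφ.isLikelihood_apply i).integrable_entropy (integrable_const _) hpt
    _ = Real.log M := by simp

end Block

/-! ### The density of the labels at a given depth -/

section ProductDensity

variable {ι : Type*} [Fintype ι] {S : Type*} [MeasurableSpace S]

theorem lintegral_prod_pi (μ : ι → Measure S) [∀ i, IsProbabilityMeasure (μ i)]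
    {g : ι → S → ℝ≥0∞} (hg : ∀ i, Measurable (g i)) :
    ∫⁻ y, ∏ i, g i (y i) ∂(Measure.pi μ) = ∏ i, ∫⁻ z, g i z ∂(μ i) := by
  have h := lintegral_prod_eq_prod_lintegral_of_indepFun Finset.univ
    (fun i (y : ι → S) => g i (y i)) (iIndepFun_pi (μ := μ) (X := g) fun i => (hg i).aemeasurable)
    fun i => (hg i).comp (measurable_pi_apply i)
  rw [h]
  refine Finset.prod_congr rfl fun i _ => ?_
  rw [← (measurePreserving_eval μ i).map_eq, lintegral_map (hg i) (measurable_pi_apply i)]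

/-- On a box the indicator factorises over the coordinates along with the density, and boxes
determine the product measure. -/
theorem pi_withDensity (σ : Measure S) [IsProbabilityMeasure σ] {g : ι → S → ℝ≥0∞}
    (hg : ∀ i, Measurable (g i)) [∀ i, IsProbabilityMeasure (σ.withDensity (g i))] :
    Measure.pi (fun i => σ.withDensity (g i)) =
      (Measure.pi fun _ => σ).withDensity fun y => ∏ i, g i (y i) := by
  refine Measure.pi_eq fun s hs => ?_
  rw [withDensity_apply _ (MeasurableSet.univ_pi hs),
    ← lintegral_indicator (MeasurableSet.univ_pi hs)]
  have h : ∀ y : ι → S, (Set.pi univ s).indicator (fun y => ∏ i, g i (y i)) y =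
      ∏ i, (s i).indicator (g i) (y i) := fun y => by
    by_cases hy : y ∈ Set.pi univ s
    · rw [indicator_of_mem hy]
      exact Finset.prod_congr rfl fun i _ => (indicator_of_mem (hy i (mem_univ i)) _).symm
    · rw [indicator_of_notMem hy]
      simp only [Set.mem_pi, mem_univ, true_imp_iff, not_forall] at hy
      obtain ⟨i, hi⟩ := hy
      exact (Finset.prod_eq_zero (Finset.mem_univ i) (indicator_of_notMem hi _)).symm
  simp only [h]
  rw [lintegral_prod_pi _ fun i => (hg i).indicator (hs i)]
  refine Finset.prod_congr rfl fun i _ => ?_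
  rw [lintegral_indicator (hs i), withDensity_apply _ (hs i)]

end ProductDensity

/-! ### Recursion from the observed level towards the root -/

section Tree

variable {S : Type*} [MeasurableSpace S] {σ : Measure S} [IsProbabilityMeasure σ]
  {φ : S → S → ℝ} {M : ℝ} {V : Type*} {G : SimpleGraph V}

theorem stepKernel_apply (K : Kernel S S) [IsMarkovKernel K] (hG : G.IsTree) (r : V)
    [∀ k, Fintype (Level G r k)] (k : ℕ) (x : Level G r k → S) :
    stepKernel K hG r k x = Measure.pi fun u => K (x (parent hG r k u)) := by
  simp only [stepKernel, Kernel.coe_mk]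
  congr!

theorem lintegral_ofReal_avg (hφ : IsSymmDensity σ φ M) {h : S → ℝ} {C : ℝ} (hm : Measurable h)
    (hb : ∀ x, |h x| ≤ C) (h0 : ∀ x, 0 ≤ h x) (x : S) :
    ∫⁻ z, ENNReal.ofReal (h z) ∂(σ.withDensity fun y => ENNReal.ofReal (φ x y)) =
      ENNReal.ofReal (avg σ φ h x) := by
  rw [lintegral_withDensity_eq_lintegral_mul _ (hφ.measurable_right x).ennreal_ofReal
    hm.ennreal_ofReal, avg, ofReal_integral_eq_lintegral_ofReal (hφ.integrable_mul hm hb x)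
    (Eventually.of_forall fun y => mul_nonneg (hφ.nonneg x y) (h0 y))]
  refine lintegral_congr fun y => ?_
  rw [ENNReal.ofReal_mul (hφ.nonneg x y)]
  rfl

variable {K : Kernel S S} [IsMarkovKernel K] {lm δ : ℝ}

/-- Downward induction over the depth: the labels at depth `k`, given those at depth `i`, have a
density which is a product of likelihoods over the vertices at depth `i + 1`. -/
theorem exists_likelihood (hφ : IsSymmDensity σ φ M)
    (hK : ∀ x, K x = σ.withDensity fun y => ENNReal.ofReal (φ x y))
    (hgap : HasVarianceContraction σ φ lm) (hδ : 0 ≤ δ)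
    (hB : (2 + δ) * (1 + δ) / 2 * √M ^ δ * lm ^ 2 ≤ 1)
    (hG : G.IsTree) (r : V) [∀ k, Fintype (Level G r k)] (k : ℕ) :
    ∀ n i : ℕ, i + 1 + n = k →
      ∃ (anc : Level G r k → Level G r (i + 1))
        (a : Level G r (i + 1) → S → (Level G r k → S) → ℝ),
        (∀ u, IsLikelihood σ {l | anc l = u} (a u)) ∧
        ∑ u, info σ (a u) ≤ (2 / (2 + δ)) ^ n * (Fintype.card (Level G r k) * Real.log M) ∧
        ∀ (x₀ : S) (B : Set (Level G r k → S)), MeasurableSet B →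
          levelKernel K hG r k x₀ B = ∫⁻ x, ∫⁻ y in B,
            ∏ u, ENNReal.ofReal (a u (x (parent hG r i u)) y) ∂(Measure.pi fun _ => σ)
            ∂(levelKernel K hG r i x₀) := by
  classical
  intro n
  induction n with
  | zero =>
    rintro i rfl
    -- The last edge is not contracted: every vertex at depth `k` contributes its full log M, hence
    -- the exponent `n` rather than `n + 1`.
    refine ⟨id, fun u x y => φ x (y u), fun u => hφ.isLikelihood_apply u, ?_, ?_⟩
    · rw [pow_zero, one_mul]
      refine (Finset.sum_le_sum fun u _ => hφ.info_apply_le u).trans_eq ?_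
      simp
    · intro x₀ B hBm
      rw [levelKernel]
      rw [Kernel.comp_apply' _ _ _ hBm]
      refine lintegral_congr fun x => ?_
      have hprob : ∀ u : Level G r (i + 1), IsProbabilityMeasure
          (σ.withDensity fun y => ENNReal.ofReal (φ (x (parent hG r i u)) y)) := fun u => by
        rw [← hK]; infer_instance
      rw [stepKernel_apply]
      simp only [hK]
      rw [pi_withDensity σ fun u => (hφ.measurable_right _).ennreal_ofReal,
        withDensity_apply _ hBm]
  | succ n ih =>
    intro i hi
    obtain ⟨anc, a, ha, hsum, hker⟩ := ih (i + 1) (by omega)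
    -- The likelihood of everything observed below `v`, given the label of `v`: its children's
    -- contributions multiply.
    set L : Level G r (i + 1) → S → (Level G r k → S) → ℝ := fun v x y =>
      ∏ u ∈ Finset.univ.filter (fun u => parent hG r (i + 1) u = v), a u x y with hLdef
    have hL : ∀ v, IsLikelihood σ {l | parent hG r (i + 1) (anc l) = v} (L v) ∧ info σ (L v) ≤
        ∑ u ∈ Finset.univ.filter (fun u => parent hG r (i + 1) u = v), info σ (a u) := fun v => by
      have := IsLikelihood.prod ha (Finset.univ.filter fun u => parent hG r (i + 1) u = v)
      simpa only [Finset.mem_filter, Finset.mem_univ, true_and] using this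
    refine ⟨fun l => parent hG r (i + 1) (anc l),
      fun v x y => avg σ φ (fun z => L v z y) x, fun v => (hL v).1.avg hφ, ?_, ?_⟩
    · have hη : 0 ≤ 2 / (2 + δ) := by positivity
      calc ∑ v, info σ (fun x y => avg σ φ (fun z => L v z y) x)
          ≤ ∑ v, 2 / (2 + δ) * ∑ u ∈ Finset.univ.filter (fun u => parent hG r (i + 1) u = v),
              info σ (a u) := Finset.sum_le_sum fun v _ =>
            ((hL v).1.info_avg_le hφ hgap hδ hB).trans (mul_le_mul_of_nonneg_left (hL v).2 hη)
        _ = 2 / (2 + δ) * ∑ u, info σ (a u) := by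
            rw [← Finset.mul_sum, Finset.sum_fiberwise]
        _ ≤ 2 / (2 + δ) * ((2 / (2 + δ)) ^ n * (Fintype.card (Level G r k) * Real.log M)) :=
            mul_le_mul_of_nonneg_left hsum hη
        _ = _ := by ring
    · intro x₀ B hBm
      have hmeas_prod : Measurable (Function.uncurry fun (x : Level G r (i + 1) → S)
          (y : Level G r k → S) =>
          ∏ u, ENNReal.ofReal (a u (x (parent hG r (i + 1) u)) y)) := by
        refine Finset.measurable_prod _ fun u _ => Measurable.ennreal_ofReal ?_
        have hm : Measurable fun q : (Level G r (i + 1) → S) × (Level G r k → S) =>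
            (q.1 (parent hG r (i + 1) u), q.2) :=
          ((measurable_pi_apply _).comp measurable_fst).prodMk measurable_snd
        exact (ha u).meas.comp hm
      rw [hker x₀ B hBm, levelKernel]
      rw [Kernel.lintegral_comp]
      · refine lintegral_congr fun x' => ?_
        rw [stepKernel_apply, lintegral_lintegral_swap hmeas_prod.aemeasurable]
        refine lintegral_congr fun y => ?_
        have h1 : ∀ x : Level G r (i + 1) → S,
            ∏ u, ENNReal.ofReal (a u (x (parent hG r (i + 1) u)) y) =
            ∏ v, ENNReal.ofReal (L v (x v) y) := fun x => by
          rw [← Finset.prod_fiberwise Finset.univ (parent hG r (i + 1))]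
          refine Finset.prod_congr rfl fun v _ => ?_
          simp only [hLdef]
          rw [ENNReal.ofReal_prod_of_nonneg fun u _ => (ha u).nonneg _ _]
          refine Finset.prod_congr rfl fun u hu => ?_
          rw [(Finset.mem_filter.1 hu).2]
        simp only [h1]
        -- Given depth `i`, the labels at depth `i + 1` are independent, so integrating them out
        -- averages each `L v` separately over the edge above `v`.
        rw [lintegral_prod_pi _ fun v => ((hL v).1.measurable_left y).ennreal_ofReal]
        refine Finset.prod_congr rfl fun v _ => ?_
        obtain ⟨D, hD⟩ := (hL v).1.exists_abs_le
        rw [hK, lintegral_ofReal_avg hφ ((hL v).1.measurable_left y) (fun x => hD x y)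
          fun x => (hL v).1.nonneg x y]
      · exact hmeas_prod.lintegral_prod_right

/-- All vertices at depth 1 hang from the root, so the product of their likelihoods is a single
likelihood for the root label. -/
theorem exists_level_density (hφ : IsSymmDensity σ φ M)
    (hK : ∀ x, K x = σ.withDensity fun y => ENNReal.ofReal (φ x y))
    (hgap : HasVarianceContraction σ φ lm) (hδ : 0 ≤ δ)
    (hB : (2 + δ) * (1 + δ) / 2 * √M ^ δ * lm ^ 2 ≤ 1)
    (hG : G.IsTree) (r : V) [∀ k, Fintype (Level G r k)] (n : ℕ) :
    ∃ (A : Set (Level G r (n + 1))) (p : S → (Level G r (n + 1) → S) → ℝ), IsLikelihood σ A p ∧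
      info σ p ≤ (2 / (2 + δ)) ^ n * (Fintype.card (Level G r (n + 1)) * Real.log M) ∧
      ∀ x, levelKernel K hG r (n + 1) x =
        (Measure.pi fun _ => σ).withDensity fun y => ENNReal.ofReal (p x y) := by
  obtain ⟨anc, a, ha, hsum, hker⟩ :=
    exists_likelihood hφ hK hgap hδ hB hG r (n + 1) n 0 (by omega)
  have hp := IsLikelihood.prod ha Finset.univ
  refine ⟨_, _, hp.1, hp.2.trans hsum, fun x => ?_⟩
  ext B hBm
  have hmeas_prod : Measurable (Function.uncurry fun (x : Level G r 0 → S)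
      (y : Level G r (n + 1) → S) =>
      ∏ u, ENNReal.ofReal (a u (x (parent hG r 0 u)) y)) := by
    refine Finset.measurable_prod _ fun u _ => Measurable.ennreal_ofReal ?_
    have hm : Measurable fun q : (Level G r 0 → S) × (Level G r (n + 1) → S) =>
        (q.1 (parent hG r 0 u), q.2) :=
      ((measurable_pi_apply _).comp measurable_fst).prodMk measurable_snd
    exact (ha u).meas.comp hm
  rw [hker x B hBm, levelKernel, Kernel.deterministic_apply,
    lintegral_dirac' _ hmeas_prod.lintegral_prod_right, withDensity_apply _ hBm]
  refine lintegral_congr fun y => ?_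
  rw [ENNReal.ofReal_prod_of_nonneg fun u _ => (ha u).nonneg _ _]

end Tree

/-! ### Total variation and mutual information -/

/-- Pointwise comparison of Hellinger distance and relative entropy, from log t ≤ t - 1 at t = √b /
√a. -/
theorem sq_sqrt_sub_sqrt_le {a b : ℝ} (ha : 0 ≤ a) (hb : 0 < b) :
    (√a - √b) ^ 2 ≤ mulLog a - a * Real.log b - a + b := by
  rcases ha.eq_or_lt with rfl | ha
  · simp [Real.sq_sqrt hb.le]
  have hsa := Real.sqrt_pos.2 ha
  have hsb := Real.sqrt_pos.2 hb
  have h1 := Real.log_le_sub_one_of_pos (div_pos hsb hsa)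
  rw [Real.log_div hsb.ne' hsa.ne', Real.log_sqrt ha.le, Real.log_sqrt hb.le] at h1
  have h2 := mul_le_mul_of_nonneg_left h1 (show 0 ≤ 2 * a by linarith)
  have h3 : 2 * a * (√b / √a - 1) = 2 * (√a * √b) - 2 * a := by
    have : a * (√b / √a) = √a * √b := by
      nth_rewrite 1 [← Real.mul_self_sqrt ha.le]
      field_simp
    linear_combination 2 * this
  have h4 : (√a - √b) ^ 2 = a - 2 * (√a * √b) + b := by
    rw [sub_sq, Real.sq_sqrt ha.le, Real.sq_sqrt hb.le]; ring
  simp only [mulLog]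
  rw [h4]
  linarith

/-- Factor a - b through square roots and apply the weighted arithmetic–geometric inequality.
Keeping ε free makes the bound linear in the entropy, so it can be integrated over the observation
directly. -/
theorem abs_sub_le_add_entropy {a b ε : ℝ} (ha : 0 ≤ a) (hb : 0 < b) (hε : 0 < ε) :
    |a - b| ≤ ε * (a + b) + (2 * ε)⁻¹ * (mulLog a - a * Real.log b - a + b) := by
  have h1 := sq_sqrt_sub_sqrt_le ha hb
  have h2 : |a - b| = |√a - √b| * (√a + √b) := by
    rw [← abs_of_nonneg (show 0 ≤ √a + √b by positivity), ← abs_mul]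
    congr 1
    have := Real.sq_sqrt ha
    have := Real.sq_sqrt hb.le
    linarith
  have h3 : (√a + √b) ^ 2 ≤ 2 * (a + b) := by
    have := Real.sq_sqrt ha
    have := Real.sq_sqrt hb.le
    nlinarith [sq_nonneg (√a - √b)]
  have h4 : |√a - √b| * (√a + √b) ≤
      ε / 2 * (√a + √b) ^ 2 + (2 * ε)⁻¹ * |√a - √b| ^ 2 := by
    have h5 : 0 ≤ (2 * ε)⁻¹ * (|√a - √b| - ε * (√a + √b)) ^ 2 := by positivity
    have h6 : (2 * ε)⁻¹ * (|√a - √b| - ε * (√a + √b)) ^ 2 =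
        ε / 2 * (√a + √b) ^ 2 + (2 * ε)⁻¹ * |√a - √b| ^ 2 - |√a - √b| * (√a + √b) := by
      field_simp; ring
    linarith
  rw [sq_abs] at h4
  have h7 := mul_le_mul_of_nonneg_left h3 (show 0 ≤ ε / 2 by linarith)
  have h8 := mul_le_mul_of_nonneg_left h1 (show 0 ≤ (2 * ε)⁻¹ by positivity)
  rw [h2]
  linarith

/-! ### Bayes' formula and a Pinsker type bound for the posterior -/

section Posterior

variable {S : Type*} [MeasurableSpace S] {σ : Measure S} [IsProbabilityMeasure σ]
  {ι : Type*} [Fintype ι] {A : Set ι} {p : S → (ι → S) → ℝ}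

theorem IsLikelihood.integral_abs_sub_evidence_le (hp : IsLikelihood σ A p) {ε : ℝ} (hε : 0 < ε)
    (y : ι → S) : ∫ x, |p x y - evidence σ p y| ∂σ ≤
      2 * ε * evidence σ p y + (2 * ε)⁻¹ * entropy σ (fun x => p x y) := by
  obtain ⟨D, hD⟩ := hp.exists_abs_le
  have ip := hp.integrable_left y
  set Z := evidence σ p y with hZ
  have hent : entropy σ (fun x => p x y) = ∫ x, mulLog (p x y) ∂σ - mulLog Z := rfl
  rcases (hp.evidence_nonneg y).eq_or_lt with h | h
  · rw [← hZ] at h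
    have hae : (fun x => p x y) =ᵐ[σ] 0 :=
      (integral_eq_zero_iff_of_nonneg (fun x => hp.nonneg x y) ip).1 h.symm
    have h1 : ∫ x, |p x y - Z| ∂σ = 0 := by
      rw [← integral_zero S ℝ (μ := σ)]
      refine integral_congr_ae ?_
      filter_upwards [hae] with x hx
      simp only [Pi.zero_apply] at hx
      simp [hx, ← h]
    have h2 : ∫ x, mulLog (p x y) ∂σ = 0 := by
      rw [← integral_zero S ℝ (μ := σ)]
      refine integral_congr_ae ?_
      filter_upwards [hae] with x hx
      simp only [Pi.zero_apply] at hx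
      simp [hx]
    rw [hent, h1, h2, ← h]
    simp
  · have iml : Integrable (fun x => mulLog (p x y)) σ :=
      integrable_mulLog (hp.measurable_left y) fun x => hD x y
    have hpt : ∀ x, |p x y - Z| ≤ (2 * ε)⁻¹ * mulLog (p x y) +
        (ε - (2 * ε)⁻¹ * (Real.log Z + 1)) * p x y + (ε * Z + (2 * ε)⁻¹ * Z) * 1 := fun x => by
      have := abs_sub_le_add_entropy (hp.nonneg x y) h hε
      linarith
    have h1 := integral_mono (ip.sub (integrable_const Z)).abs
      (((iml.const_mul _).add (ip.const_mul _)).add ((integrable_const (1 : ℝ)).const_mul _)) hpt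
    have h2 : ∫ x, ((2 * ε)⁻¹ * mulLog (p x y) +
        (ε - (2 * ε)⁻¹ * (Real.log Z + 1)) * p x y + (ε * Z + (2 * ε)⁻¹ * Z) * 1) ∂σ =
        2 * ε * Z + (2 * ε)⁻¹ * entropy σ (fun x => p x y) := by
      rw [integral_linear_combination iml ip (integrable_const _), hent]
      change _ + _ * Z + _ = _
      simp only [integral_const, probReal_univ, one_smul, mulLog]
      ring
    exact h1.trans_eq h2

theorem tvDist_withDensity_le {h : S → ℝ} (hm : Measurable h) (h0 : ∀ x, 0 ≤ h x)
    (hi : Integrable h σ) :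
    tvDist (σ.withDensity fun x => ENNReal.ofReal (h x)) σ ≤
      ENNReal.ofReal (∫ x, |h x - 1| ∂σ) := by
  refine iSup₂_le fun B hB => ENNReal.ofReal_le_ofReal ?_
  have h1 : (σ.withDensity fun x => ENNReal.ofReal (h x)).real B = ∫ x in B, h x ∂σ := by
    rw [measureReal_def, withDensity_apply _ hB,
      integral_eq_lintegral_of_nonneg_ae (Eventually.of_forall h0) hm.aestronglyMeasurable]
  have h2 : σ.real B = ∫ _ in B, (1 : ℝ) ∂σ := by simp
  have hi' : Integrable (fun x => h x - 1) σ := hi.sub (integrable_const 1)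
  rw [h1, h2, ← integral_sub hi.integrableOn (integrable_const _)]
  exact (abs_integral_le_integral_abs).trans
    (setIntegral_le_integral hi'.abs (Eventually.of_forall fun x => abs_nonneg _))

/-- Bayes' formula, as a kernel. -/
noncomputable def bayesKernel (σ : Measure S) [IsProbabilityMeasure σ] (p : S → (ι → S) → ℝ) :
    Kernel (ι → S) S :=
  Kernel.withDensity (Kernel.const (ι → S) σ)
    fun y x => ENNReal.ofReal (p x y / evidence σ p y)

theorem IsLikelihood.measurable_posterior (hp : IsLikelihood σ A p) :
    Measurable (Function.uncurry fun y x => p x y / evidence σ p y) :=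
  (hp.meas.comp measurable_swap).div (hp.measurable_evidence.comp measurable_fst)

theorem IsLikelihood.bayesKernel_apply (hp : IsLikelihood σ A p) (y : ι → S) :
    bayesKernel σ p y = σ.withDensity fun x => ENNReal.ofReal (p x y / evidence σ p y) := by
  rw [bayesKernel, Kernel.withDensity_apply, Kernel.const_apply]
  exact hp.measurable_posterior.ennreal_ofReal

theorem IsLikelihood.ofReal_evidence (hp : IsLikelihood σ A p) (y : ι → S) :
    ENNReal.ofReal (evidence σ p y) = ∫⁻ x, ENNReal.ofReal (p x y) ∂σ :=
  ofReal_integral_eq_lintegral_ofReal (hp.integrable_left y)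
    (Eventually.of_forall fun x => hp.nonneg x y)

/-- Bayes' formula with the denominator cleared. It survives zero evidence because the likelihood
then vanishes for almost every label. -/
theorem IsLikelihood.ofReal_evidence_mul (hp : IsLikelihood σ A p) (y : ι → S)
    {B : Set S} (hB : MeasurableSet B) :
    ENNReal.ofReal (evidence σ p y) * bayesKernel σ p y B =
      ∫⁻ x in B, ENNReal.ofReal (p x y) ∂σ := by
  rw [hp.bayesKernel_apply, withDensity_apply _ hB, ← lintegral_const_mul' _ _ ENNReal.ofReal_ne_top]
  rcases (hp.evidence_nonneg y).eq_or_lt with h | h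
  · have h1 := hp.ofReal_evidence y
    simp only [← h, ENNReal.ofReal_zero, zero_mul, lintegral_const] at h1 ⊢
    refine le_antisymm zero_le ?_
    rw [h1]
    exact setLIntegral_le_lintegral _ _
  · refine lintegral_congr fun x => ?_
    rw [← ENNReal.ofReal_mul h.le, mul_div_cancel₀ _ h.ne']

/-- Where the evidence is 0, division by zero makes the measure 0, so the kernel need not be Markov;
its mass is still at most 1. -/
theorem IsLikelihood.isFiniteKernel_bayesKernel (hp : IsLikelihood σ A p) :
    IsFiniteKernel (bayesKernel σ p) := by
  refine ⟨1, ENNReal.one_lt_top, fun y => ?_⟩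
  rcases (hp.evidence_nonneg y).eq_or_lt with h | h
  · rw [hp.bayesKernel_apply]
    simp [← h]
  · have h1 := hp.ofReal_evidence_mul y MeasurableSet.univ
    rw [Measure.restrict_univ, ← hp.ofReal_evidence] at h1
    have h2 : ENNReal.ofReal (evidence σ p y) ≠ 0 := by simpa using h
    exact ((ENNReal.mul_eq_left h2 ENNReal.ofReal_ne_top).1 h1).le

variable [StandardBorelSpace S] [Nonempty S] {κ : Kernel S (ι → S)} [IsMarkovKernel κ]

theorem IsLikelihood.bind_eq (hp : IsLikelihood σ A p)
    (hκ : ∀ x, κ x = (Measure.pi fun _ => σ).withDensity fun y => ENNReal.ofReal (p x y)) :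
    σ.bind κ =
      (Measure.pi fun _ => σ).withDensity fun y => ENNReal.ofReal (evidence σ p y) := by
  ext B hB
  rw [Measure.bind_apply hB κ.aemeasurable, withDensity_apply _ hB]
  simp only [hκ, withDensity_apply _ hB, hp.ofReal_evidence]
  exact lintegral_lintegral_swap hp.meas.ennreal_ofReal.aemeasurable

/-- The posterior is determined almost everywhere by the joint law of label and observation, which
is compared on rectangles by Fubini. -/
theorem IsLikelihood.posterior_ae_eq (hp : IsLikelihood σ A p)
    (hκ : ∀ x, κ x = (Measure.pi fun _ => σ).withDensity fun y => ENNReal.ofReal (p x y)) :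
    bayesKernel σ p =ᵐ[σ.bind κ] posterior κ σ := by
  have := hp.isFiniteKernel_bayesKernel
  refine ae_eq_posterior_of_compProd_eq ?_
  refine Measure.ext_prod fun {s t} hs ht => ?_
  rw [Measure.compProd_apply_prod hs ht, Measure.map_apply measurable_swap (hs.prod ht),
    Set.preimage_swap_prod, Measure.compProd_apply_prod ht hs, hp.bind_eq hκ,
    setLIntegral_withDensity_eq_setLIntegral_mul _ hp.measurable_evidence.ennreal_ofReal
      ((bayesKernel σ p).measurable_coe ht) hs]
  simp only [Pi.mul_apply, hp.ofReal_evidence_mul _ ht, hκ, withDensity_apply _ hs]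
  exact lintegral_lintegral_swap (hp.meas.ennreal_ofReal.comp measurable_swap).aemeasurable

/-- A Pinsker type inequality for the expected total variation distance of the posterior. -/
theorem IsLikelihood.lintegral_tvDist_posterior_le (hp : IsLikelihood σ A p)
    (hκ : ∀ x, κ x = (Measure.pi fun _ => σ).withDensity fun y => ENNReal.ofReal (p x y))
    {ε : ℝ} (hε : 0 < ε) :
    ∫⁻ y, tvDist (posterior κ σ y) σ ∂(σ.bind κ) ≤
      ENNReal.ofReal (2 * ε + (2 * ε)⁻¹ * info σ p) := by
  obtain ⟨D, hD⟩ := hp.exists_abs_le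
  have hdiv : ∀ y, Measurable fun x => p x y / evidence σ p y := fun y =>
    (hp.measurable_left y).div_const _
  have hmeas : Measurable fun y => ENNReal.ofReal (∫ x, |p x y / evidence σ p y - 1| ∂σ) := by
    have : StronglyMeasurable
        (Function.uncurry fun y x => |p x y / evidence σ p y - 1|) :=
      (measurable_norm.comp (hp.measurable_posterior.sub_const 1)).stronglyMeasurable
    exact this.integral_prod_right.measurable.ennreal_ofReal
  calc ∫⁻ y, tvDist (posterior κ σ y) σ ∂(σ.bind κ)
      = ∫⁻ y, tvDist (bayesKernel σ p y) σ ∂(σ.bind κ) := by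
        refine lintegral_congr_ae ?_
        filter_upwards [hp.posterior_ae_eq hκ] with y hy
        rw [hy]
    _ ≤ ∫⁻ y, ENNReal.ofReal (∫ x, |p x y / evidence σ p y - 1| ∂σ) ∂(σ.bind κ) := by
        refine lintegral_mono fun y => ?_
        rw [hp.bayesKernel_apply]
        exact tvDist_withDensity_le (hdiv y)
          (fun x => div_nonneg (hp.nonneg x y) (hp.evidence_nonneg y))
          ((hp.integrable_left y).div_const _)
    -- The observation has density `evidence σ p`, and this factor cancels the denominator of the
    -- posterior.
    _ = ∫⁻ y, ENNReal.ofReal (evidence σ p y) *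
          ENNReal.ofReal (∫ x, |p x y / evidence σ p y - 1| ∂σ) ∂(Measure.pi fun _ => σ) := by
        rw [hp.bind_eq hκ, lintegral_withDensity_eq_lintegral_mul _
          hp.measurable_evidence.ennreal_ofReal hmeas]
        rfl
    _ ≤ ∫⁻ y, ENNReal.ofReal (2 * ε * evidence σ p y + (2 * ε)⁻¹ *
          entropy σ (fun x => p x y)) ∂(Measure.pi fun _ => σ) := by
        refine lintegral_mono fun y => ?_
        rcases (hp.evidence_nonneg y).eq_or_lt with h | h
        · rw [← h]; simp
        · rw [← ENNReal.ofReal_mul h.le]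
          refine ENNReal.ofReal_le_ofReal ?_
          refine le_trans (le_of_eq ?_) (hp.integral_abs_sub_evidence_le hε y)
          rw [← integral_const_mul]
          refine integral_congr_ae (Eventually.of_forall fun x => ?_)
          simp only
          rw [← abs_of_pos h, ← abs_mul, abs_of_pos h, mul_sub, mul_div_cancel₀ _ h.ne', mul_one]
    _ = ENNReal.ofReal (2 * ε + (2 * ε)⁻¹ * info σ p) := by
        have i1 : Integrable (evidence σ p) (Measure.pi fun _ => σ) :=
          integrable_of_measurable_of_bound hp.measurable_evidence
            fun y => abs_integral_le_of_bound fun x => hD x y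
        rw [← ofReal_integral_eq_lintegral_ofReal]
        · rw [integral_add (i1.const_mul _) (hp.integrable_entropy.const_mul _),
            integral_const_mul, integral_const_mul, hp.integral_evidence, mul_one]
          rfl
        · exact (i1.const_mul _).add (hp.integrable_entropy.const_mul _)
        · exact Eventually.of_forall fun y =>
            (integral_nonneg fun x => abs_nonneg _).trans (hp.integral_abs_sub_evidence_le hε y)

end Posterior

/-! ### Integral operators with continuous symmetric kernel -/

section IntegralOperator

variable {X : Type*} [TopologicalSpace X] [CompactSpace X] [MeasurableSpace X] [BorelSpace X]
  {σ : Measure X} [IsFiniteMeasure σ]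

theorem inner_toLp_curry (k : C(X × X, ℝ)) (u : Lp ℝ 2 σ) (x : X) :
    ⟪ContinuousMap.toLp 2 σ ℝ (k.curry x), u⟫_ℝ = ∫ y, k (x, y) * u y ∂σ := by
  rw [L2.inner_def]
  refine integral_congr_ae ?_
  filter_upwards [ContinuousMap.coeFn_toLp (p := 2) (𝕜 := ℝ) σ (k.curry x)] with y hy
  rw [hy]
  simp [mul_comm]

theorem continuous_toLp_curry (k : C(X × X, ℝ)) :
    Continuous fun x => ContinuousMap.toLp 2 σ ℝ (k.curry x) :=
  (ContinuousMap.toLp 2 σ ℝ).continuous.comp k.curry.continuous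

/-- The integral operator with kernel `k`, from `L²` to the continuous functions. -/
noncomputable def kernelOperatorAux (σ : Measure X) [IsFiniteMeasure σ] (k : C(X × X, ℝ)) :
    Lp ℝ 2 σ →L[ℝ] BoundedContinuousFunction X ℝ :=
  LinearMap.mkContinuousOfExistsBound
    { toFun := fun u => BoundedContinuousFunction.mkOfCompact
        ⟨fun x => ⟪ContinuousMap.toLp 2 σ ℝ (k.curry x), u⟫_ℝ,
          (continuous_toLp_curry k).inner continuous_const⟩
      map_add' := fun u v => by ext x; simp [inner_add_right]
      map_smul' := fun c u => by ext x; simp [inner_smul_right] } <| by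
    obtain ⟨C, hC⟩ := isCompact_univ.exists_bound_of_continuousOn
      (continuous_toLp_curry (σ := σ) k).continuousOn
    refine ⟨|C|, fun u => (BoundedContinuousFunction.norm_le (by positivity)).2 fun x => ?_⟩
    refine (norm_inner_le_norm (𝕜 := ℝ) (ContinuousMap.toLp 2 σ ℝ (k.curry x)) u).trans ?_
    exact mul_le_mul_of_nonneg_right ((hC x (mem_univ x)).trans (le_abs_self C)) (norm_nonneg _)

theorem kernelOperatorAux_apply (k : C(X × X, ℝ)) (u : Lp ℝ 2 σ) (x : X) :
    kernelOperatorAux σ k u x = ⟪ContinuousMap.toLp 2 σ ℝ (k.curry x), u⟫_ℝ := rfl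

/-- Arzelà–Ascoli: x ↦ k(x, ·) is continuous into L², so by Cauchy–Schwarz the image of the unit
ball is equicontinuous and pointwise bounded. -/
theorem isCompactOperator_kernelOperatorAux (k : C(X × X, ℝ)) :
    IsCompactOperator (kernelOperatorAux σ k) := by
  refine (isCompactOperator_iff_isCompact_closure_image_closedBall
    (kernelOperatorAux σ k : Lp ℝ 2 σ →ₗ[ℝ] BoundedContinuousFunction X ℝ) zero_lt_one).2 ?_
  have hle : ∀ u ∈ Metric.closedBall (0 : Lp ℝ 2 σ) 1, ‖u‖ ≤ 1 := fun u hu => by simpa using hu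
  refine BoundedContinuousFunction.arzela_ascoli
    (Metric.closedBall (0 : ℝ) ‖kernelOperatorAux σ k‖) (isCompact_closedBall _ _) _ ?_ ?_
  · rintro _ x ⟨u, hu, rfl⟩
    rw [mem_closedBall_zero_iff]
    refine ((kernelOperatorAux σ k u).norm_coe_le_norm x).trans ?_
    refine ((kernelOperatorAux σ k).le_opNorm u).trans ?_
    exact mul_le_of_le_one_right (norm_nonneg _) (hle u hu)
  · intro x₀
    refine Metric.equicontinuousAt_of_continuity_modulus
      (fun x => ‖ContinuousMap.toLp 2 σ ℝ (k.curry x₀) - ContinuousMap.toLp 2 σ ℝ (k.curry x)‖)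
      ?_ _ (Eventually.of_forall ?_)
    · have hc : Continuous fun x =>
          ‖ContinuousMap.toLp 2 σ ℝ (k.curry x₀) - ContinuousMap.toLp 2 σ ℝ (k.curry x)‖ :=
        (continuous_const.sub (continuous_toLp_curry k)).norm
      simpa using hc.tendsto x₀
    · rintro x ⟨_, u, hu, rfl⟩
      change dist (kernelOperatorAux σ k u x₀) (kernelOperatorAux σ k u x) ≤ _
      rw [kernelOperatorAux_apply, kernelOperatorAux_apply, dist_eq_norm, ← inner_sub_left]
      exact (norm_inner_le_norm _ _).trans (mul_le_of_le_one_right (norm_nonneg _) (hle u hu))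

/-- The integral operator with kernel `k` on `L²`. -/
noncomputable def kernelOperator (σ : Measure X) [IsFiniteMeasure σ] (k : C(X × X, ℝ)) :
    Lp ℝ 2 σ →L[ℝ] Lp ℝ 2 σ :=
  (BoundedContinuousFunction.toLp 2 σ ℝ).comp (kernelOperatorAux σ k)

theorem isCompactOperator_kernelOperator (k : C(X × X, ℝ)) :
    IsCompactOperator (kernelOperator σ k) :=
  (isCompactOperator_kernelOperatorAux k).clm_comp (BoundedContinuousFunction.toLp 2 σ ℝ)

theorem kernelOperator_ae_eq (k : C(X × X, ℝ)) (u : Lp ℝ 2 σ) :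
    kernelOperator σ k u =ᵐ[σ] fun x => ∫ y, k (x, y) * u y ∂σ := by
  filter_upwards [BoundedContinuousFunction.coeFn_toLp (p := 2) (𝕜 := ℝ) σ
    (kernelOperatorAux σ k u)] with x hx
  rw [← inner_toLp_curry, ← kernelOperatorAux_apply, ← hx]
  rfl

theorem isSymmetric_kernelOperator [SecondCountableTopology X] {k : C(X × X, ℝ)}
    (hk : ∀ x y, k (x, y) = k (y, x)) : (kernelOperator σ k).IsSymmetric := by
  obtain ⟨C, hC⟩ := isCompact_univ.exists_bound_of_continuousOn k.continuous.continuousOn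
  intro u v
  have hu : Integrable u σ := (Lp.memLp u).integrable (by norm_num)
  have hv : Integrable v σ := (Lp.memLp v).integrable (by norm_num)
  have hint : Integrable (Function.uncurry fun x y => k (x, y) * u y * v x) (σ.prod σ) := by
    have h1 : Integrable (fun z : X × X => v z.1 * u z.2) (σ.prod σ) := hv.mul_prod hu
    have h2 := h1.bdd_mul (c := C) (f := fun z => k z) k.continuous.aestronglyMeasurable
      (Eventually.of_forall fun z => hC z (mem_univ z))
    refine h2.congr (Eventually.of_forall fun z => ?_)
    simp only [Function.uncurry]; ring
  have h1 : ⟪kernelOperator σ k u, v⟫_ℝ = ∫ x, ∫ y, k (x, y) * u y * v x ∂σ ∂σ := by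
    rw [L2.inner_def]
    refine integral_congr_ae ?_
    filter_upwards [kernelOperator_ae_eq k u] with x hx
    rw [hx, integral_mul_const]
    simp [mul_comm]
  have h2 : ⟪u, kernelOperator σ k v⟫_ℝ = ∫ y, ∫ x, k (x, y) * u y * v x ∂σ ∂σ := by
    rw [L2.inner_def]
    refine integral_congr_ae ?_
    filter_upwards [kernelOperator_ae_eq k v] with y hy
    rw [hy]
    simp only [RCLike.inner_apply, conj_trivial]
    rw [← integral_mul_const]
    refine integral_congr_ae (Eventually.of_forall fun x => ?_)
    simp only [hk y x]; ring
  change ⟪kernelOperator σ k u, v⟫_ℝ = ⟪u, kernelOperator σ k v⟫_ℝ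
  rw [h1, h2, integral_integral_swap hint]

end IntegralOperator

/-- A self-adjoint operator has norm equal to its spectral radius, and nonzero spectral values of a
compact operator are eigenvalues. -/
theorem norm_le_of_forall_hasEigenvalue {H : Type*} [NormedAddCommGroup H] [InnerProductSpace ℝ H]
    [CompleteSpace H] {T : H →L[ℝ] H} (hT : IsCompactOperator T) (hs : T.IsSymmetric) {lm : ℝ}
    (hlm : 0 ≤ lm)
    (h : ∀ m : ℝ, m ≠ 0 → Module.End.HasEigenvalue (T : Module.End ℝ H) m → |m| ≤ lm) :
    ‖T‖ ≤ lm := by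
  have h1 := T.spectralRadius_eq_nnnorm hs.isSelfAdjoint
  have h2 : spectralRadius ℝ T ≤ (lm.toNNReal : ℝ≥0∞) := by
    refine iSup₂_le fun m hm => ?_
    rw [ENNReal.coe_le_coe, ← NNReal.coe_le_coe, coe_nnnorm, Real.coe_toNNReal _ hlm]
    rcases eq_or_ne m 0 with rfl | hm0
    · simpa using hlm
    · exact h m hm0 ((hT.hasEigenvalue_iff_mem_spectrum hm0).2 hm)
  rw [h1, ENNReal.coe_le_coe, ← NNReal.coe_le_coe, coe_nnnorm, Real.coe_toNNReal _ hlm] at h2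
  exact h2

/-- If all eigenvalues with a mean zero eigenfunction are at most `lm` in absolute value, then the
averaging operator contracts the variance. -/
theorem hasVarianceContraction_of_forall_eigenvalue {X : Type*} [TopologicalSpace X]
    [CompactSpace X] [SecondCountableTopology X] [MeasurableSpace X] [BorelSpace X] {σ : Measure X}
    [IsProbabilityMeasure σ] {φ : X → X → ℝ} {M lm : ℝ} (hφ : IsSymmDensity σ φ M)
    (hc : Continuous (Function.uncurry φ)) (hlm : 0 ≤ lm)
    (h : ∀ (m : ℝ) (ψ : X → ℝ), MemLp ψ 2 σ → ¬ ψ =ᵐ[σ] 0 → ∫ x, ψ x ∂σ = 0 →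
      ((fun x => ∫ y, φ x y * ψ y ∂σ) =ᵐ[σ] fun x => m * ψ x) → |m| ≤ lm) :
    HasVarianceContraction σ φ lm := by
  -- Subtracting 1 removes the projection onto constants. Eigenfunctions of the new operator with
  -- nonzero eigenvalue have mean zero and are eigenfunctions of A, so its norm is at most `lm`;
  -- applied to `u - c`, this is the variance contraction.
  let k : C(X × X, ℝ) := ⟨fun z => φ z.1 z.2 - 1, hc.sub continuous_const⟩
  have hk : ∀ x y, k (x, y) = φ x y - 1 := fun _ _ => rfl
  have hks : ∀ x y, k (x, y) = k (y, x) := fun x y => by rw [hk, hk, hφ.symm]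
  have hsymm := isSymmetric_kernelOperator (σ := σ) hks
  have hint : ∀ {ψ : X → ℝ}, Integrable ψ σ → ∀ x,
      ∫ y, k (x, y) * ψ y ∂σ = ∫ y, φ x y * ψ y ∂σ - ∫ y, ψ y ∂σ := by
    intro ψ hψ x
    have h1 : Integrable (fun y => φ x y * ψ y) σ :=
      hψ.bdd_mul (c := M) (hφ.measurable_right x).aestronglyMeasurable
        (Eventually.of_forall (hφ.abs_apply_le x))
    rw [← integral_sub h1 hψ]
    refine integral_congr_ae (Eventually.of_forall fun y => ?_)
    simp only [hk]; ring
  have hone : MemLp (fun _ : X => (1 : ℝ)) 2 σ := memLp_const 1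
  have hTone : kernelOperator σ k hone.toLp = 0 := by
    rw [Lp.eq_zero_iff_ae_eq_zero]
    filter_upwards [kernelOperator_ae_eq k hone.toLp] with x hx
    rw [hx]
    have : ∫ y, k (x, y) * (hone.toLp _ : Lp ℝ 2 σ) y ∂σ = ∫ y, k (x, y) * 1 ∂σ := by
      refine integral_congr_ae ?_
      filter_upwards [hone.coeFn_toLp] with y hy
      rw [hy]
    rw [this, hint (integrable_const 1)]
    simp [hφ.integral_eq_one]
  have hnorm : ‖kernelOperator σ k‖ ≤ lm := by
    refine norm_le_of_forall_hasEigenvalue (isCompactOperator_kernelOperator k) hsymm hlm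
      fun m hm0 hm => ?_
    obtain ⟨ψ, hψ⟩ := hm.exists_hasEigenvector
    have hψi : Integrable ψ σ := (Lp.memLp ψ).integrable (by norm_num)
    have hTψ : kernelOperator σ k ψ = m • ψ := hψ.apply_eq_smul
    have hinner : ⟪hone.toLp, ψ⟫_ℝ = ∫ x, ψ x ∂σ := by
      rw [L2.inner_def]
      refine integral_congr_ae ?_
      filter_upwards [hone.coeFn_toLp] with y hy
      rw [hy]
      simp
    have hmean : ∫ x, ψ x ∂σ = 0 := by
      have h1 : ⟪kernelOperator σ k hone.toLp, ψ⟫_ℝ = ⟪hone.toLp, kernelOperator σ k ψ⟫_ℝ :=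
        hsymm _ _
      rw [hTone, hTψ, inner_zero_left, inner_smul_right, hinner] at h1
      exact (mul_eq_zero.1 h1.symm).resolve_left hm0
    refine h m ψ (Lp.memLp ψ) (fun h0 => hψ.2 (Lp.eq_zero_iff_ae_eq_zero.2 h0)) hmean ?_
    have h2 : ⇑(m • ψ) =ᵐ[σ] m • ⇑ψ := Lp.coeFn_smul m ψ
    filter_upwards [kernelOperator_ae_eq k ψ, h2] with x hx hx2
    rw [hTψ, hx2, hint hψi, hmean, sub_zero] at hx
    exact hx.symm
  intro u C hm hb
  set c := ∫ x, u x ∂σ with hcdef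
  have iu : Integrable u σ := integrable_of_measurable_of_bound hm hb
  have hb2 : ∀ {w : X → ℝ}, (∀ x, |w x| ≤ C) → ∀ y, |w y ^ 2| ≤ C ^ 2 := fun hw y => by
    rw [abs_pow]; exact pow_le_pow_left₀ (abs_nonneg _) (hw y) 2
  have iu2 : Integrable (fun x => u x ^ 2) σ :=
    integrable_of_measurable_of_bound (hm.pow_const 2) (hb2 hb)
  have hAm := hφ.measurable_avg hm
  have hAb := hφ.abs_avg_le hm hb
  have iA : Integrable (avg σ φ u) σ := integrable_of_measurable_of_bound hAm hAb
  have iA2 : Integrable (fun x => avg σ φ u x ^ 2) σ :=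
    integrable_of_measurable_of_bound (hAm.pow_const 2) (hb2 hAb)
  have hvm : Measurable fun x => u x - c := hm.sub_const c
  have hv : MemLp (fun x => u x - c) 2 σ :=
    MemLp.of_bound hvm.aestronglyMeasurable (C + |c|)
      (Eventually.of_forall fun x => (norm_sub_le _ _).trans (add_le_add_left (hb x) _))
  have hTv : kernelOperator σ k hv.toLp =ᵐ[σ] fun x => avg σ φ u x - c := by
    filter_upwards [kernelOperator_ae_eq k hv.toLp] with x hx
    rw [hx]
    have h1 : ∫ y, k (x, y) * (hv.toLp _ : Lp ℝ 2 σ) y ∂σ = ∫ y, k (x, y) * (u y - c) ∂σ := by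
      refine integral_congr_ae ?_
      filter_upwards [hv.coeFn_toLp] with y hy
      rw [hy]
    rw [h1, hint (ψ := fun y => u y - c) (iu.sub (integrable_const c)), integral_sub iu (integrable_const c), ← hcdef]
    have h2 : ∫ y, φ x y * (u y - c) ∂σ = avg σ φ u x - c := by
      simp only [mul_sub]
      rw [integral_sub (hφ.integrable_mul hm hb x) ((hφ.integrable x).mul_const c),
        integral_mul_const, hφ.integral_eq_one, one_mul]
      rfl
    rw [h2]
    simp
  have hsq : ∀ {w : X → ℝ} (W : Lp ℝ 2 σ), W =ᵐ[σ] w → ‖W‖ ^ 2 = ∫ x, w x ^ 2 ∂σ := by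
    intro w W hW
    rw [← real_inner_self_eq_norm_sq, L2.inner_def]
    refine integral_congr_ae ?_
    filter_upwards [hW] with x hx
    rw [hx]
    simp [sq]
  have hexpand : ∀ {w : X → ℝ}, Integrable w σ → Integrable (fun x => w x ^ 2) σ →
      ∫ x, w x ∂σ = c → ∫ x, (w x - c) ^ 2 ∂σ = ∫ x, w x ^ 2 ∂σ - c ^ 2 := by
    intro w hw hw2 hwc
    have : ∀ x, (w x - c) ^ 2 = 1 * w x ^ 2 + (-2 * c) * w x + c ^ 2 * 1 := fun x => by ring
    simp only [this]
    rw [integral_linear_combination hw2 hw (integrable_const _), hwc]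
    simp; ring
  have h1 := (kernelOperator σ k).le_of_opNorm_le hnorm hv.toLp
  have h2 := pow_le_pow_left₀ (norm_nonneg _) h1 2
  rw [mul_pow, hsq _ hTv, hsq _ hv.coeFn_toLp, hexpand iu iu2 rfl,
    hexpand iA iA2 (hφ.integral_avg hm hb)] at h2
  linarith

/-! ### The sphere -/

section Sphere

variable {d : ℕ} [NeZero d] {f : ℝ → ℝ}

open scoped Pointwise in
-- Spherical measure is defined through cones, and Lebesgue measure is invariant under negation. The
-- symmetry is needed to exclude decreasing `f`.
theorem map_neg_toSphere : (volume : Measure (EuclideanSpace ℝ (Fin d))).toSphere.map Neg.neg =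
    (volume : Measure (EuclideanSpace ℝ (Fin d))).toSphere := by
  ext s hs
  have hneg : Measurable (Neg.neg : Sph d → Sph d) := continuous_neg.measurable
  rw [Measure.map_apply hneg hs, Measure.toSphere_apply' _ (hneg hs),
    Measure.toSphere_apply' _ hs]
  congr 1
  rw [← Measure.measure_neg volume
    (Ioo (0 : ℝ) 1 • (Subtype.val '' s : Set (EuclideanSpace ℝ (Fin d))))]
  congr 1
  ext z
  simp only [Set.mem_neg, Set.mem_smul, mem_image, mem_preimage]
  constructor
  · rintro ⟨t, ht, _, ⟨x, hx, rfl⟩, rfl⟩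
    exact ⟨t, ht, _, ⟨-x, hx, rfl⟩, by simp⟩
  · rintro ⟨t, ht, _, ⟨x, hx, rfl⟩, hz⟩
    refine ⟨t, ht, _, ⟨-x, by simpa using hx, rfl⟩, ?_⟩
    rw [← neg_neg z, ← hz]
    simp

theorem map_neg_unif : (unif d).map Neg.neg = unif d := by
  rw [unif, Measure.map_smul, map_neg_toSphere]

theorem integral_comp_neg_unif (g : Sph d → ℝ) :
    ∫ x, g (-x) ∂(unif d) = ∫ x, g x ∂(unif d) := by
  have hemb : MeasurableEmbedding (Neg.neg : Sph d → Sph d) :=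
    (Homeomorph.neg (Sph d)).measurableEmbedding
  conv_rhs => rw [← map_neg_unif]
  rw [hemb.integral_map]

theorem inner_mem_Icc (x y : Sph d) :
    ⟪(x : EuclideanSpace ℝ (Fin d)), (y : EuclideanSpace ℝ (Fin d))⟫_ℝ ∈ Icc (-1 : ℝ) 1 := by
  have h := abs_real_inner_le_norm (x : EuclideanSpace ℝ (Fin d)) (y : EuclideanSpace ℝ (Fin d))
  simp only [norm_eq_of_mem_sphere, mul_one] at h
  exact abs_le.1 h

theorem phi_comm (x y : Sph d) : phi f x y = phi f y x := by
  rw [phi, phi, real_inner_comm]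

theorem continuous_phi (hf : ContinuousOn f (Icc (-1 : ℝ) 1)) :
    Continuous (Function.uncurry (phi f : Sph d → Sph d → ℝ)) := by
  refine hf.comp_continuous (f := fun z : Sph d × Sph d =>
    ⟪(z.1 : EuclideanSpace ℝ (Fin d)), (z.2 : EuclideanSpace ℝ (Fin d))⟫_ℝ) ?_
    fun z => inner_mem_Icc z.1 z.2
  exact (continuous_subtype_val.comp continuous_fst).inner
    (continuous_subtype_val.comp continuous_snd)

theorem sphereKernel_apply (hf : ContinuousOn f (Icc (-1 : ℝ) 1)) (x : Sph d) :
    sphereKernel d f x = (unif d).withDensity fun y => ENNReal.ofReal (phi f x y) := by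
  rw [sphereKernel, Kernel.withDensity_apply, Kernel.const_apply]
  exact (continuous_phi hf).measurable.ennreal_ofReal

theorem integral_phi [IsMarkovKernel (sphereKernel d f)]
    (hf0 : ∀ t ∈ Icc (-1 : ℝ) 1, 0 ≤ f t) (hf : ContinuousOn f (Icc (-1 : ℝ) 1)) (x : Sph d) :
    ∫ y, phi f x y ∂(unif d) = 1 := by
  have h1 : sphereKernel d f x univ = 1 := measure_univ
  rw [sphereKernel_apply hf, withDensity_apply _ MeasurableSet.univ, Measure.restrict_univ] at h1
  have hm : Measurable (phi f x) := (continuous_phi hf).measurable.comp measurable_prodMk_left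
  have h0 : ∀ y, 0 ≤ phi f x y := fun y => hf0 _ (inner_mem_Icc x y)
  rw [integral_eq_lintegral_of_nonneg_ae (Eventually.of_forall h0)
    hm.aestronglyMeasurable, h1, ENNReal.toReal_one]

theorem isSymmDensity_phi [IsMarkovKernel (sphereKernel d f)]
    (hf0 : ∀ t ∈ Icc (-1 : ℝ) 1, 0 ≤ f t) (hmono : MonotoneOn f (Icc (-1 : ℝ) 1))
    (hf : ContinuousOn f (Icc (-1 : ℝ) 1)) :
    IsSymmDensity (unif d) (phi f) (f 1) where
  meas := (continuous_phi hf).measurable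
  nonneg x y := hf0 _ (inner_mem_Icc x y)
  le x y := hmono (inner_mem_Icc x y) (by norm_num) (inner_mem_Icc x y).2
  symm := phi_comm
  integral_eq_one := integral_phi hf0 hf

theorem continuous_lam_integrand (hf : ContinuousOn f (Icc (-1 : ℝ) 1)) :
    Continuous fun x : Sph d =>
      ⟪(x : EuclideanSpace ℝ (Fin d)), (northPole d : EuclideanSpace ℝ (Fin d))⟫_ℝ *
        phi f (northPole d) x :=
  (continuous_subtype_val.inner continuous_const).mul
    ((continuous_phi hf).comp (Continuous.prodMk_right (northPole d)))

theorem integrable_of_continuous_unif {g : Sph d → ℝ} (hg : Continuous g) :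
    Integrable g (unif d) := by
  obtain ⟨C, hC⟩ := isCompact_univ.exists_bound_of_continuousOn hg.continuousOn
  exact integrable_of_measurable_of_bound hg.measurable fun x => hC x (mem_univ x)

theorem lam_le_one [IsMarkovKernel (sphereKernel d f)]
    (hf0 : ∀ t ∈ Icc (-1 : ℝ) 1, 0 ≤ f t) (hf : ContinuousOn f (Icc (-1 : ℝ) 1)) :
    lam d f ≤ 1 := by
  rw [← integral_phi hf0 hf (northPole d)]
  refine integral_mono (integrable_of_continuous_unif (continuous_lam_integrand hf))
    (integrable_of_continuous_unif
      ((continuous_phi hf).comp (Continuous.prodMk_right (northPole d)))) fun x => ?_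
  exact mul_le_of_le_one_left (hf0 _ (inner_mem_Icc _ _)) (inner_mem_Icc _ _).2

/-- Pair x with -x: the integrand becomes t (f(t) - f(-t)), which is at most 0 when f decreases. -/
theorem lam_nonpos_of_antitoneOn (hf : ContinuousOn f (Icc (-1 : ℝ) 1))
    (hanti : AntitoneOn f (Icc (-1 : ℝ) 1)) : lam d f ≤ 0 := by
  set g : Sph d → ℝ := fun x =>
    ⟪(x : EuclideanSpace ℝ (Fin d)), (northPole d : EuclideanSpace ℝ (Fin d))⟫_ℝ *
      phi f (northPole d) x with hg
  have hc : Continuous g := continuous_lam_integrand hf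
  have i2 : Integrable (fun x => g (-x)) (unif d) :=
    integrable_of_continuous_unif (hc.comp continuous_neg)
  have hlam : lam d f = ∫ x, g x ∂(unif d) := rfl
  have hsum : lam d f + lam d f ≤ 0 := by
    have h2 : lam d f + lam d f = ∫ x, (g x + g (-x)) ∂(unif d) := by
      rw [integral_add (integrable_of_continuous_unif hc) i2, integral_comp_neg_unif, hlam]
    rw [h2]
    refine integral_nonpos fun x => ?_
    have hx := inner_mem_Icc x (northPole d)
    simp only [hg, phi, coe_neg_sphere, inner_neg_left, inner_neg_right, Pi.zero_apply,
      real_inner_comm (x : EuclideanSpace ℝ (Fin d)) (northPole d : EuclideanSpace ℝ (Fin d))]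
    set t := ⟪(x : EuclideanSpace ℝ (Fin d)), (northPole d : EuclideanSpace ℝ (Fin d))⟫_ℝ
    have hx' : -t ∈ Icc (-1 : ℝ) 1 := ⟨by linarith [hx.2], by linarith [hx.1]⟩
    rcases le_total 0 t with h | h
    · have := hanti hx' hx (by linarith)
      nlinarith
    · have := hanti hx hx' (by linarith)
      nlinarith
  linarith

end Sphere

/-! ### The threshold -/

/-- The quantity controlling the percolation threshold. -/
noncomputable def rate (lm M : ℝ) : ℝ :=
  Real.log lm * (1 - lm) ^ 2 / Real.log (lm * (1 - lm) / M)

theorem log_four_gt : (1 : ℝ) < Real.log 4 := by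
  have : Real.log 4 = 2 * Real.log 2 := by
    rw [show (4 : ℝ) = 2 ^ 2 by norm_num, Real.log_pow]; norm_num
  linarith [Real.log_two_gt_d9]

/-- With δ = `rate lm M` and D = log(M / (λ(1-λ))), one has δ D ≤ -log λ, where (1-λ)² ≤ 1 is all
that is used of that factor, and D ≥ log 4 + log M > 1 + log M since λ(1-λ) ≤ 1/4. The logarithm of
the last product is at most 3δ/2 + (δ/2) log M + 2 log λ ≤ (3/2) δ D + 2 log λ ≤ 0. -/
theorem rate_bounds {lm M : ℝ} (h0 : 0 < lm) (h1 : lm < 1) (hM : 1 ≤ M) :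
    0 < rate lm M ∧ rate lm M ≤ 1 ∧
      (2 + rate lm M) * (1 + rate lm M) / 2 * √M ^ rate lm M * lm ^ 2 ≤ 1 := by
  have hM0 : 0 < M := by linarith
  have hlog : Real.log lm < 0 := Real.log_neg h0 h1
  have h1' : 0 < 1 - lm := by linarith
  have hLM : 0 ≤ Real.log M := Real.log_nonneg hM
  have hden : Real.log (lm * (1 - lm) / M) = Real.log lm + Real.log (1 - lm) - Real.log M := by
    rw [Real.log_div (by positivity) hM0.ne', Real.log_mul h0.ne' h1'.ne']
  have hlog1 : Real.log (1 - lm) ≤ 0 := Real.log_nonpos h1'.le (by linarith)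
  have hquarter : Real.log lm + Real.log (1 - lm) ≤ - Real.log 4 := by
    rw [← Real.log_mul h0.ne' h1'.ne', ← Real.log_inv]
    exact Real.log_le_log (by positivity) (by nlinarith [sq_nonneg (2 * lm - 1)])
  have hfour := log_four_gt
  set D := -Real.log (lm * (1 - lm) / M) with hD
  have hD1 : Real.log 4 + Real.log M ≤ D := by linarith
  have hD2 : -Real.log lm ≤ D := by linarith
  have hD0 : 0 < D := by linarith
  have hR : rate lm M = -Real.log lm * (1 - lm) ^ 2 / D := by
    rw [rate, hD, neg_mul, neg_div_neg_eq]
  have hRpos : 0 < rate lm M := by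
    rw [hR]
    exact div_pos (mul_pos (by linarith) (by positivity)) hD0
  have hsq : (1 - lm) ^ 2 ≤ 1 := by nlinarith
  have hRD : rate lm M * D ≤ -Real.log lm := by
    rw [hR, div_mul_cancel₀ _ hD0.ne']
    exact mul_le_of_le_one_right (by linarith) hsq
  have hR1 : rate lm M ≤ 1 := by
    by_contra! hcon
    nlinarith
  refine ⟨hRpos, hR1, ?_⟩
  set δ := rate lm M
  have e1 : (2 + δ) * (1 + δ) / 2 ≤ Real.exp (δ / 2) * Real.exp δ := by
    have ha := Real.add_one_le_exp (δ / 2)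
    have hb := Real.add_one_le_exp δ
    calc (2 + δ) * (1 + δ) / 2 = (δ / 2 + 1) * (δ + 1) := by ring
      _ ≤ _ := mul_le_mul ha hb (by linarith) (Real.exp_pos _).le
  have e2 : √M ^ δ = Real.exp (Real.log M / 2 * δ) := by
    rw [Real.rpow_def_of_pos (Real.sqrt_pos.2 hM0), Real.log_sqrt hM0.le]
  have e3 : lm ^ 2 = Real.exp (2 * Real.log lm) := by
    rw [mul_comm, Real.exp_mul, Real.exp_log h0, Real.rpow_two]
  calc (2 + δ) * (1 + δ) / 2 * √M ^ δ * lm ^ 2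
      ≤ Real.exp (δ / 2) * Real.exp δ * √M ^ δ * lm ^ 2 := by gcongr
    _ = Real.exp (δ / 2 + δ + Real.log M / 2 * δ + 2 * Real.log lm) := by
        rw [e2, e3, ← Real.exp_add, ← Real.exp_add, ← Real.exp_add]
    _ ≤ 1 := by
        rw [Real.exp_le_one_iff]
        have : δ * (Real.log 4 + Real.log M) ≤ δ * D := mul_le_mul_of_nonneg_left hD1 hRpos.le
        nlinarith [mul_nonneg hRpos.le hLM, mul_lt_mul_of_pos_left hfour hRpos]

/-- This is where the constant 1/4 enters: (2+R)(1 - R/4) = 2 + R/2 - R²/4 exceeds 2 for 0 < R ≤ 1.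
-/
theorem two_mul_lt_of_le_inv {q R : ℝ} (hR0 : 0 < R) (hR1 : R ≤ 1)
    (hq : q ≤ (1 - 1 / 4 * R)⁻¹) : 2 / (2 + R) * q < 1 := by
  have hpos : 0 < 1 - 1 / 4 * R := by linarith
  rw [← one_div, le_div_iff₀ hpos] at hq
  rw [div_mul_eq_mul_div, div_lt_one (by linarith)]
  have : 2 * q * (1 - 1 / 4 * R) < (2 + R) * (1 - 1 / 4 * R) := by nlinarith
  exact lt_of_mul_lt_mul_right this hpos.le

theorem tendsto_zero_of_le_ofReal {F : ℕ → ℝ≥0∞} {I : ℕ → ℝ} (hI : Tendsto I atTop (𝓝 0))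
    (h : ∀ n, ∀ ε : ℝ, 0 < ε → F n ≤ ENNReal.ofReal (2 * ε + (2 * ε)⁻¹ * I n)) :
    Tendsto F atTop (𝓝 0) := by
  rw [ENNReal.tendsto_nhds_zero]
  intro e he
  obtain ⟨ε, hε, hεe⟩ : ∃ ε : ℝ, 0 < ε ∧ ENNReal.ofReal (3 * ε) ≤ e := by
    rcases eq_or_ne e ∞ with rfl | htop
    · exact ⟨1, one_pos, le_top⟩
    · have := ENNReal.toReal_pos he.ne' htop
      refine ⟨e.toReal / 3, by positivity, ?_⟩
      rw [mul_div_cancel₀ _ (by norm_num), ENNReal.ofReal_toReal htop]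
  have hlim : Tendsto (fun n => (2 * ε)⁻¹ * I n) atTop (𝓝 0) := by
    simpa using hI.const_mul (2 * ε)⁻¹
  filter_upwards [hlim.eventually_lt_const hε] with n hn
  exact (h n ε hε).trans ((ENNReal.ofReal_le_ofReal (by linarith)).trans hεe)

theorem zeroPercolation_of_lam_lt_one {d : ℕ} [NeZero d] {f : ℝ → ℝ}
    [IsMarkovKernel (sphereKernel d f)]
    (hf0 : ∀ t ∈ Icc (-1 : ℝ) 1, 0 ≤ f t) (hmono : MonotoneOn f (Icc (-1 : ℝ) 1))
    (hf : ContinuousOn f (Icc (-1 : ℝ) 1)) (hlam : 0 < lam d f) (hlam1 : lam d f < 1)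
    (heig : ∀ m : ℝ, IsNonconstantEigenvalue d f m → |m| ≤ lam d f)
    {V : Type*} {G : SimpleGraph V} (hG : G.IsTree) (r : V) [∀ k, Finite (Level G r k)]
    {q : ℝ} (hgrowth : GrowthAtMost G r q) (hq : q ≤ (1 - 1 / 4 * rate (lam d f) (f 1))⁻¹) :
    ZeroPercolation d f hG r := by
  have hφ := isSymmDensity_phi (d := d) hf0 hmono hf
  have hM := hφ.one_le
  obtain ⟨hR0, hR1, hB⟩ := rate_bounds hlam hlam1 hM
  set R := rate (lam d f) (f 1)
  have hηq := two_mul_lt_of_le_inv hR0 hR1 hq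
  have hgap : HasVarianceContraction (unif d) (phi f) (lam d f) :=
    hasVarianceContraction_of_forall_eigenvalue hφ (continuous_phi hf) hlam.le
      fun m ψ h1 h2 h3 h4 => heig m ⟨ψ, h1, h2, h3, h4⟩
  let inst : ∀ k, Fintype (Level G r k) := fun k => Fintype.ofFinite _
  have hlogM : 0 ≤ Real.log (f 1) := Real.log_nonneg hM
  have hη : 0 ≤ 2 / (2 + R) := by positivity
  have hq1 := hgrowth.1
  -- Rounding up costs at most a factor 2, because `q ^ (n + 1) ≥ 1`.
  have hcard : ∀ n : ℕ, (Fintype.card (Level G r (n + 1)) : ℝ) ≤ 2 * q ^ (n + 1) := fun n => by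
    rw [Fintype.card_eq_nat_card]
    have h1 : (Nat.card (Level G r (n + 1)) : ℝ) ≤ (⌈q ^ (n + 1)⌉₊ : ℝ) := by
      exact_mod_cast hgrowth.2 (n + 1)
    have h2 := Nat.ceil_lt_add_one (show 0 ≤ q ^ (n + 1) by positivity)
    have h3 : 1 ≤ q ^ (n + 1) := one_le_pow₀ hq1.le
    linarith
  -- Depth 0 is skipped: there the observation is the root label itself, and only deeper levels are
  -- supplied with a bounded density.
  rw [ZeroPercolation, ← tendsto_add_atTop_iff_nat 1]
  refine tendsto_zero_of_le_ofReal
    (I := fun n => 2 * q * Real.log (f 1) * (2 / (2 + R) * q) ^ n) ?_ fun n ε hε => ?_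
  · simpa using (tendsto_pow_atTop_nhds_zero_of_lt_one (by positivity) hηq).const_mul
      (2 * q * Real.log (f 1))
  · obtain ⟨A, p, hp, hinfo, hκ⟩ := exists_level_density (K := sphereKernel d f) hφ
      (sphereKernel_apply hf) hgap hR0.le hB hG r n
    refine (hp.lintegral_tvDist_posterior_le hκ hε).trans (ENNReal.ofReal_le_ofReal ?_)
    have h1 : info (unif d) p ≤ 2 * q * Real.log (f 1) * (2 / (2 + R) * q) ^ n := by
      refine hinfo.trans ?_
      calc (2 / (2 + R)) ^ n * (Fintype.card (Level G r (n + 1)) * Real.log (f 1))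
          ≤ (2 / (2 + R)) ^ n * (2 * q ^ (n + 1) * Real.log (f 1)) := by
            gcongr
            exact hcard n
        _ = _ := by rw [mul_pow, pow_succ]; ring
    gcongr

theorem theorem3 :
    ∃ c : ℝ, 0 < c ∧
      ∀ (d : ℕ) [NeZero d] (f : ℝ → ℝ) [IsMarkovKernel (sphereKernel d f)]
        (_hf_nonneg : ∀ t ∈ Set.Icc (-1 : ℝ) 1, 0 ≤ f t)
        (_hf_mono : MonotoneOn f (Set.Icc (-1 : ℝ) 1) ∨ AntitoneOn f (Set.Icc (-1 : ℝ) 1))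
        (_hf_cont : ContinuousOn f (Set.Icc (-1 : ℝ) 1))
        (_hlam_pos : 0 < lam d f)
        (_hlam_max : ∀ m : ℝ, IsNonconstantEigenvalue d f m → |m| ≤ lam d f)
        (V : Type*) (G : SimpleGraph V) (hG : G.IsTree) (r : V) [∀ k, Finite (Level G r k)]
        (q : ℝ) (_hgrowth : GrowthAtMost G r q)
        (_hq : q ≤ (1 - c * (Real.log (lam d f) * (1 - lam d f) ^ 2 /
          Real.log (lam d f * (1 - lam d f) / f 1)))⁻¹),
        ZeroPercolation d f hG r := by
  refine ⟨1 / 4, by norm_num, ?_⟩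
  intro d _ f _ hf0 hmono hf hlam heig V G hG r _ q hgrowth hq
  -- Since λ > 0, `f` must be increasing, so that its maximum is `f 1`.
  have hmono' : MonotoneOn f (Icc (-1 : ℝ) 1) := hmono.resolve_right fun hanti =>
    absurd (lam_nonpos_of_antitoneOn (d := d) hf hanti) (not_le.2 hlam)
  rcases (lam_le_one (d := d) hf0 hf).lt_or_eq with h1 | h1
  · exact zeroPercolation_of_lam_lt_one hf0 hmono' hf hlam h1 heig hG r hgrowth hq
  -- At λ = 1 the logarithm in the numerator vanishes and the threshold reads q ≤ 1, against q > 1.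
  · rw [h1] at hq
    norm_num at hq
    exact absurd hgrowth.1 (not_lt.2 hq)
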